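/- Let $F$ be an algebraically closed field of characteristic $p>3$, let $n\ge 2$, $d=\tfrac12 n(n-1)$, and let $\mathfrak g=\mathfrak g_{\bar 0}\oplus\mathfrak g_{\bar 1}$ be the Lie superalgebra $\mathfrak p(n)$ of block matrices $\begin{pmatrix}a&b\\c&-a^t\end{pmatrix}$, where $a,b,c$ are $n\times n$ matrices over $F$, $b$ is symmetric and $c$ is skew-symmetric. Here $\mathfrak g_{\bar 0}$ is given by $b=c=0$, and $\mathfrak g_{\bar 1}$ by $a=0$; let $\mathfrak g_{1}$ be the subspace $a=c=0$. Let $u(\mathfrak g)$ be the restricted enveloping superalgebra, i.e. the quotient of $U(\mathfrak g)$ by the ideal generated by all $x^p-x^{[p]}$ with $x\in\mathfrak g_{\bar 0}$, where $x^{[p]}$ is the $p$-th power of the matrix $x$. Let $\bar{\mathfrak u}=u(\mathfrak g)/I$, where $I$ is the two-sided ideal generated by the products of $k$ elements of $\mathfrak g_1$, for all $k>d$. The group $G=GL_n(F)$ acts on $\mathfrak g$ by conjugation with $\mathrm{diag}(g,(g^{-1})^t)$, and hence on $\bar{\mathfrak u}$ by algebra automorphisms; let $T\subset G$ be the diagonal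 torus. Put $$\mathcal Z=\{z\in\bar{\mathfrak u}_{\bar 0}\mid gz=z\ \text{for all}\ g\in G,\ \ [z,\mathfrak g_{\bar 1}]=0\}.$$ Let $\mathfrak h\subset\mathfrak g_{\bar 0}$ be the diagonal matrices, with basis $h_i=e_{ii}-e_{n+i,n+i}$ $(1\le i\le n)$, so that $u(\mathfrak h)=F[h_1,\dots,h_n]/(h_i^p-h_i\mid 1\le i\le n)$. Let $\mathfrak n^+\subset\mathfrak g$ be the subspace of matrices with $c=0$ and $a$ strictly upper triangular, and let $\mathfrak l=\bar{\mathfrak u}\,\mathfrak n^+\cap\bar{\mathfrak u}^T$. Let $\rho\in\mathfrak h^*$ be given by $\rho(h_i)=-i$, and let $W=S_n$ act on $\mathfrak h^*$ by permuting the coordinates $\mu_i=\mu(h_i)$. The dot action of $W$ on $\mathfrak h^*$ is $w\cdot\mu=w(\mu+\rho)-\rho$; that on polynomial functions, $(w\cdot f)(\mu)=f(w^{-1}\cdot\mu)$, induces a dot action on $u(\mathfrak h)$, with invariants $u(\mathfrak h)^{W\cdot}$. Let $\Theta\in u(\mathfrak h)$ be the image of the polynomial function $$\Theta(\mu)=\prod_{i\ne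 j}\bigl((h_i-h_j)(\mu+\rho)-1\bigr),$$ the product being over ordered pairs. Assume $p>2d=n(n-1)$. Then the canonical map $u(\mathfrak h)\to\bar{\mathfrak u}$ is injective and $\bar{\mathfrak u}^T=u(\mathfrak h)\oplus\mathfrak l$, so that the Harish-Chandra projection $h:\bar{\mathfrak u}^T\to u(\mathfrak h)$ with kernel $\mathfrak l$ is defined, and $$h(\mathcal Z)\subseteq\Theta\,u(\mathfrak h)^{W\cdot}+F .$$ -/

import Mathlib

/-! The periplectic Lie superalgebra `p(n)`, its restricted enveloping superalgebra, the quotient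
`ū`, the central subalgebra `𝒵` and the Harish-Chandra projection. -/

namespace Periplectic

section LieSuperalgebra

/-- The `2n × 2n` matrices over `F`, in `n × n` blocks. -/
abbrev Mat (n : ℕ) (F : Type*) := Matrix (Fin n ⊕ Fin n) (Fin n ⊕ Fin n) F

/-- The underlying space of `p(n)`: block matrices `(a, b; c, -aᵀ)` with `b` symmetric and
`c` skew-symmetric. -/
def pn (n : ℕ) (F : Type*) [Field F] : Submodule F (Mat n F) where
  carrier := {X | X.toBlocks₂₂ = -X.toBlocks₁₁.transpose ∧
    X.toBlocks₁₂.transpose = X.toBlocks₁₂ ∧ X.toBlocks₂₁.transpose = -X.toBlocks₂₁}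
  zero_mem' := by
    refine ⟨?_, ?_, ?_⟩ <;> ext i j <;>
      simp [Matrix.toBlocks₁₁, Matrix.toBlocks₁₂, Matrix.toBlocks₂₁, Matrix.toBlocks₂₂]
  add_mem' := by
    rintro X Y ⟨h1, h2, h3⟩ ⟨k1, k2, k3⟩
    refine ⟨?_, ?_, ?_⟩ <;> ext i j
    · have := congrFun₂ h1 i j; have := congrFun₂ k1 i j
      simp_all [Matrix.toBlocks₁₁, Matrix.toBlocks₂₂]; ring
    · have := congrFun₂ h2 i j; have := congrFun₂ k2 i j
      simp_all [Matrix.toBlocks₁₂]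
    · have := congrFun₂ h3 i j; have := congrFun₂ k3 i j
      simp_all [Matrix.toBlocks₂₁]; ring
  smul_mem' := by
    rintro c X ⟨h1, h2, h3⟩
    refine ⟨?_, ?_, ?_⟩ <;> ext i j
    · have := congrFun₂ h1 i j
      simp_all [Matrix.toBlocks₁₁, Matrix.toBlocks₂₂]
    · have := congrFun₂ h2 i j
      simp_all [Matrix.toBlocks₁₂]
    · have := congrFun₂ h3 i j
      simp_all [Matrix.toBlocks₂₁]

variable {n : ℕ} {F : Type*} [Field F]

theorem mem_pn_fromBlocks {A B C D : Matrix (Fin n) (Fin n) F} :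
    Matrix.fromBlocks A B C D ∈ pn n F ↔
      D = -A.transpose ∧ B.transpose = B ∧ C.transpose = -C := Iff.rfl

variable (n F) in
/-- The even part `𝔤_0̄`: matrices with `b = c = 0`. -/
def even : Submodule F (pn n F) where
  carrier := {x | (x : Mat n F).toBlocks₁₂ = 0 ∧ (x : Mat n F).toBlocks₂₁ = 0}
  zero_mem' := ⟨rfl, rfl⟩
  add_mem' := by
    rintro x y ⟨h1, h2⟩ ⟨k1, k2⟩
    exact ⟨(congrArg₂ (· + ·) h1 k1).trans (add_zero 0),
      (congrArg₂ (· + ·) h2 k2).trans (add_zero 0)⟩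
  smul_mem' := by
    rintro c x ⟨h1, h2⟩
    exact ⟨(congrArg (c • ·) h1).trans (smul_zero c), (congrArg (c • ·) h2).trans (smul_zero c)⟩

variable (n F) in
/-- The odd part `𝔤_1̄ = 𝔤_{-1} ⊕ 𝔤_1`: matrices with `a = 0`. -/
def odd : Submodule F (pn n F) where
  carrier := {x | (x : Mat n F).toBlocks₁₁ = 0 ∧ (x : Mat n F).toBlocks₂₂ = 0}
  zero_mem' := ⟨rfl, rfl⟩
  add_mem' := by
    rintro x y ⟨h1, h2⟩ ⟨k1, k2⟩
    exact ⟨(congrArg₂ (· + ·) h1 k1).trans (add_zero 0),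
      (congrArg₂ (· + ·) h2 k2).trans (add_zero 0)⟩
  smul_mem' := by
    rintro c x ⟨h1, h2⟩
    exact ⟨(congrArg (c • ·) h1).trans (smul_zero c), (congrArg (c • ·) h2).trans (smul_zero c)⟩

variable (n F) in
/-- The component `𝔤_1` of the `ℤ`-grading: matrices with `a = 0` and `c = 0`. -/
def degOne : Submodule F (pn n F) where
  carrier := {x | x ∈ odd n F ∧ (x : Mat n F).toBlocks₂₁ = 0}
  zero_mem' := ⟨(odd n F).zero_mem, rfl⟩
  add_mem' := by
    rintro x y ⟨h1, h2⟩ ⟨k1, k2⟩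
    exact ⟨(odd n F).add_mem h1 k1, (congrArg₂ (· + ·) h2 k2).trans (add_zero 0)⟩
  smul_mem' := by
    rintro c x ⟨h1, h2⟩
    exact ⟨(odd n F).smul_mem c h1, (congrArg (c • ·) h2).trans (smul_zero c)⟩

variable (n F) in
/-- `𝔫⁺ = 𝔫₀⁺ ⊕ 𝔤_1`, spanned by the root vectors of the positive roots `ε_i - ε_j` (`i < j`)
and `ε_i + ε_j` (`i ≤ j`): matrices with `c = 0` and `a` strictly upper triangular. -/
def nPlus : Submodule F (pn n F) where
  carrier := {x | (x : Mat n F).toBlocks₂₁ = 0 ∧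
    ∀ i j : Fin n, j ≤ i → (x : Mat n F) (Sum.inl i) (Sum.inl j) = 0}
  zero_mem' := ⟨rfl, fun _ _ _ => rfl⟩
  add_mem' := by
    rintro x y ⟨h1, h2⟩ ⟨k1, k2⟩
    refine ⟨(congrArg₂ (· + ·) h1 k1).trans (add_zero 0), fun i j hij => ?_⟩
    simp [h2 i j hij, k2 i j hij]
  smul_mem' := by
    rintro c x ⟨h1, h2⟩
    refine ⟨(congrArg (c • ·) h1).trans (smul_zero c), fun i j hij => ?_⟩
    simp [h2 i j hij]

/-- If one of two homogeneous elements is even, their superbracket is the commutator. -/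
theorem comm_mem (x y : pn n F) (hx : x ∈ even n F) (hy : y ∈ even n F ∨ y ∈ odd n F) :
    (x : Mat n F) * y - y * x ∈ pn n F := by
  obtain ⟨X, hX⟩ := x
  obtain ⟨Y, hY⟩ := y
  obtain ⟨A, B, C, D, rfl⟩ : ∃ A B C D, X = Matrix.fromBlocks A B C D :=
    ⟨_, _, _, _, (Matrix.fromBlocks_toBlocks X).symm⟩
  obtain ⟨A', B', C', D', rfl⟩ : ∃ A B C D, Y = Matrix.fromBlocks A B C D :=
    ⟨_, _, _, _, (Matrix.fromBlocks_toBlocks Y).symm⟩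
  obtain ⟨h1, h2, h3⟩ := mem_pn_fromBlocks.1 hX
  obtain ⟨k1, k2, k3⟩ := mem_pn_fromBlocks.1 hY
  obtain ⟨e1, e2⟩ : B = 0 ∧ C = 0 := hx
  subst h1 k1 e1 e2
  simp only [Matrix.fromBlocks_multiply, sub_eq_add_neg, Matrix.fromBlocks_neg,
    Matrix.fromBlocks_add]
  rw [mem_pn_fromBlocks]
  refine ⟨?_, ?_, ?_⟩
  · simp
  · simp [k2, add_comm]
  · simp [k3]

/-- The superbracket of two odd elements is the anticommutator. -/
theorem anticomm_mem (x y : pn n F) (hx : x ∈ odd n F) (hy : y ∈ odd n F) :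
    (x : Mat n F) * y + y * x ∈ pn n F := by
  obtain ⟨X, hX⟩ := x
  obtain ⟨Y, hY⟩ := y
  obtain ⟨A, B, C, D, rfl⟩ : ∃ A B C D, X = Matrix.fromBlocks A B C D :=
    ⟨_, _, _, _, (Matrix.fromBlocks_toBlocks X).symm⟩
  obtain ⟨A', B', C', D', rfl⟩ : ∃ A B C D, Y = Matrix.fromBlocks A B C D :=
    ⟨_, _, _, _, (Matrix.fromBlocks_toBlocks Y).symm⟩
  obtain ⟨h1, h2, h3⟩ := mem_pn_fromBlocks.1 hX
  obtain ⟨k1, k2, k3⟩ := mem_pn_fromBlocks.1 hY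
  obtain ⟨rfl, e2⟩ : A = 0 ∧ D = 0 := hx
  obtain ⟨rfl, e4⟩ : A' = 0 ∧ D' = 0 := hy
  subst e2 e4
  simp only [Matrix.fromBlocks_multiply, Matrix.fromBlocks_add]
  rw [mem_pn_fromBlocks]
  refine ⟨?_, ?_, ?_⟩
  · simp [h2, h3, k2, k3]
  · simp
  · simp

/-- `𝔤_0̄` is closed under `p`-th powers of matrices. -/
theorem pow_mem (p : ℕ) [Fact p.Prime] [CharP F p] (x : pn n F) (hx : x ∈ even n F) :
    (x : Mat n F) ^ p ∈ pn n F := by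
  obtain ⟨X, hX⟩ := x
  obtain ⟨A, B, C, D, rfl⟩ : ∃ A B C D, X = Matrix.fromBlocks A B C D :=
    ⟨_, _, _, _, (Matrix.fromBlocks_toBlocks X).symm⟩
  obtain ⟨h1, h2, h3⟩ := mem_pn_fromBlocks.1 hX
  obtain ⟨e1, e2⟩ : B = 0 ∧ C = 0 := hx
  subst h1 e1 e2
  have hpow : ∀ k : ℕ, (Matrix.fromBlocks A 0 0 (-A.transpose)) ^ k =
      Matrix.fromBlocks (A ^ k) 0 0 ((-A.transpose) ^ k) := by
    intro k
    induction k with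
    | zero => simp
    | succ k ih => simp [pow_succ, ih, Matrix.fromBlocks_multiply]
  have hneg : (-A.transpose) ^ p = -(A ^ p).transpose := by
    rcases (Fact.out : p.Prime).eq_two_or_odd' with rfl | hodd
    · rw [neg_sq, Matrix.transpose_pow]
      have : CharP (Matrix (Fin n) (Fin n) F) 2 ∨ IsEmpty (Fin n) := by
        rcases isEmpty_or_nonempty (Fin n) with h | h
        · exact Or.inr h
        · exact Or.inl inferInstance
      ext i j
      simp [CharTwo.neg_eq]
    · rw [hodd.neg_pow, Matrix.transpose_pow]
  show (Matrix.fromBlocks A 0 0 (-A.transpose)) ^ p ∈ pn n F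
  rw [hpow, mem_pn_fromBlocks]
  exact ⟨hneg, by simp, by simp⟩

end LieSuperalgebra

section Enveloping

variable (n : ℕ) (F : Type*) [Field F]

/-- The defining relations of the universal enveloping superalgebra:
`x y - (-1)^{|x||y|} y x = [x, y]` for homogeneous `x`, `y`. -/
inductive EnvRel : TensorAlgebra F (pn n F) → TensorAlgebra F (pn n F) → Prop
  | comm (x y : pn n F) (hx : x ∈ even n F) (hy : y ∈ even n F ∨ y ∈ odd n F) :
      EnvRel (TensorAlgebra.ι F x * TensorAlgebra.ι F y - TensorAlgebra.ι F y * TensorAlgebra.ι F x)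
        (TensorAlgebra.ι F ⟨(x : Mat n F) * y - y * x, comm_mem x y hx hy⟩)
  | anticomm (x y : pn n F) (hx : x ∈ odd n F) (hy : y ∈ odd n F) :
      EnvRel (TensorAlgebra.ι F x * TensorAlgebra.ι F y + TensorAlgebra.ι F y * TensorAlgebra.ι F x)
        (TensorAlgebra.ι F ⟨(x : Mat n F) * y + y * x, anticomm_mem x y hx hy⟩)

/-- The universal enveloping superalgebra `U(𝔤)`. -/
def U := RingQuot (EnvRel n F)

noncomputable instance : Ring (U n F) := inferInstanceAs (Ring (RingQuot (EnvRel n F)))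

noncomputable instance : Algebra F (U n F) :=
  inferInstanceAs (Algebra F (RingQuot (EnvRel n F)))

/-- The quotient map onto `U(𝔤)`. -/
noncomputable def mkU : TensorAlgebra F (pn n F) →ₐ[F] U n F := RingQuot.mkAlgHom F (EnvRel n F)

variable {n F} in
theorem mkU_rel {a b : TensorAlgebra F (pn n F)} (h : EnvRel n F a b) : mkU n F a = mkU n F b :=
  RingQuot.mkAlgHom_rel F h

/-- The canonical map `𝔤 → U(𝔤)`. -/
noncomputable def ιU : pn n F →ₗ[F] U n F :=
  (mkU n F).toLinearMap ∘ₗ TensorAlgebra.ι F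

variable (p : ℕ) [Fact p.Prime] [CharP F p]

/-- The relations `x ^ p = x^{[p]}`, `x ∈ 𝔤_0̄`, where `x^{[p]}` is the `p`-th power of the
matrix `x`. -/
inductive ResRel : U n F → U n F → Prop
  | pow (x : pn n F) (hx : x ∈ even n F) :
      ResRel (ιU n F x ^ p) (ιU n F ⟨(x : Mat n F) ^ p, pow_mem p x hx⟩)

/-- The restricted enveloping superalgebra `u(𝔤)`. -/
def u := RingQuot (ResRel n F p)

noncomputable instance : Ring (u n F p) := inferInstanceAs (Ring (RingQuot (ResRel n F p)))

noncomputable instance : Algebra F (u n F p) :=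
  inferInstanceAs (Algebra F (RingQuot (ResRel n F p)))

/-- The quotient map `U(𝔤) → u(𝔤)`. -/
noncomputable def mku : U n F →ₐ[F] u n F p := RingQuot.mkAlgHom F (ResRel n F p)

variable {n F} in
theorem mku_rel {a b : U n F} (h : ResRel n F p a b) : mku n F p a = mku n F p b :=
  RingQuot.mkAlgHom_rel F h

/-- The canonical map `𝔤 → u(𝔤)`. -/
noncomputable def ιu : pn n F →ₗ[F] u n F p :=
  (mku n F p).toLinearMap ∘ₗ ιU n F

/-- The relations killing all products of `k` elements of `𝔤_1` for
`k > d = n (n - 1) / 2 = dim 𝔤_{-1}`. -/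
inductive NilRel : u n F p → u n F p → Prop
  | prod (l : List (pn n F)) (hl : ∀ x ∈ l, x ∈ degOne n F) (hd : n * (n - 1) / 2 < l.length) :
      NilRel (l.map (ιu n F p)).prod 0

/-- The quotient superalgebra `ū = u(𝔤) / I`, with `I` the two-sided ideal generated by
`⋀^k 𝔤_1` for `k > d`. -/
def ubar := RingQuot (NilRel n F p)

noncomputable instance : Ring (ubar n F p) := inferInstanceAs (Ring (RingQuot (NilRel n F p)))

noncomputable instance : Algebra F (ubar n F p) :=
  inferInstanceAs (Algebra F (RingQuot (NilRel n F p)))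

/-- The quotient map `u(𝔤) → ū`. -/
noncomputable def mkubar : u n F p →ₐ[F] ubar n F p := RingQuot.mkAlgHom F (NilRel n F p)

variable {n F} in
theorem mkubar_rel {a b : u n F p} (h : NilRel n F p a b) : mkubar n F p a = mkubar n F p b :=
  RingQuot.mkAlgHom_rel F h

/-- The canonical map `𝔤 → ū`. -/
noncomputable def ι : pn n F →ₗ[F] ubar n F p :=
  (mkubar n F p).toLinearMap ∘ₗ ιu n F p

/-- The even part `ū_0̄`, spanned by the products of elements of `𝔤_0̄ ∪ 𝔤_1̄` with an even number
of factors from `𝔤_1̄`; in other words generated by `𝔤_0̄` and the products of two odd elements. -/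
noncomputable def ubarEven : Subalgebra F (ubar n F p) :=
  Algebra.adjoin F ({a | ∃ x ∈ even n F, ι n F p x = a} ∪
    {a | ∃ x ∈ odd n F, ∃ y ∈ odd n F, ι n F p x * ι n F p y = a})

end Enveloping

section GroupAction

variable {n : ℕ} {F : Type*} [Field F]

/-- The embedding `GL_n → GL_{2n}`, `a ↦ diag(a, (a⁻¹)ᵀ)`. -/
def rhoGL (g : GL (Fin n) F) : (Mat n F)ˣ where
  val := Matrix.fromBlocks (g : Matrix (Fin n) (Fin n) F) 0 0
    ((g⁻¹ : GL (Fin n) F) : Matrix (Fin n) (Fin n) F).transpose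
  inv := Matrix.fromBlocks ((g⁻¹ : GL (Fin n) F) : Matrix (Fin n) (Fin n) F) 0 0
    (g : Matrix (Fin n) (Fin n) F).transpose
  val_inv := by
    rw [Matrix.fromBlocks_multiply]
    simp [← Matrix.transpose_mul, ← Units.val_mul, -Matrix.coe_units_inv]
  inv_val := by
    rw [Matrix.fromBlocks_multiply]
    simp [← Matrix.transpose_mul, ← Units.val_mul, -Matrix.coe_units_inv]

theorem conj_fromBlocks (g : GL (Fin n) F) (A B C D : Matrix (Fin n) (Fin n) F) :
    (rhoGL g : Mat n F) * Matrix.fromBlocks A B C D * ((rhoGL g)⁻¹ : (Mat n F)ˣ) =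
      Matrix.fromBlocks
        (g.val * A * g.inv) (g.val * B * g.val.transpose)
        (g.inv.transpose * C * g.inv) (g.inv.transpose * D * g.val.transpose) := by
  show Matrix.fromBlocks g.val 0 0 g.inv.transpose * Matrix.fromBlocks A B C D *
    Matrix.fromBlocks g.inv 0 0 g.val.transpose = _
  simp only [Matrix.fromBlocks_multiply]
  simp

theorem conj_mem (g : GL (Fin n) F) (x : pn n F) :
    (rhoGL g : Mat n F) * x * ((rhoGL g)⁻¹ : (Mat n F)ˣ) ∈ pn n F := by
  obtain ⟨X, hX⟩ := x
  obtain ⟨A, B, C, D, rfl⟩ : ∃ A B C D, X = Matrix.fromBlocks A B C D :=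
    ⟨_, _, _, _, (Matrix.fromBlocks_toBlocks X).symm⟩
  obtain ⟨h1, h2, h3⟩ := mem_pn_fromBlocks.1 hX
  rw [conj_fromBlocks, mem_pn_fromBlocks]
  subst h1
  refine ⟨?_, ?_, ?_⟩
  · simp only [Matrix.transpose_mul, mul_neg, neg_mul, mul_assoc]
  · simp only [Matrix.transpose_mul, Matrix.transpose_transpose, h2, mul_assoc]
  · simp only [Matrix.transpose_mul, Matrix.transpose_transpose, h3, mul_neg, neg_mul, mul_assoc]

/-- The action of `G = GL_n(F)` on `𝔤`: `x ↦ ρ(g) x ρ(g)⁻¹`. -/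
def Ad (g : GL (Fin n) F) : pn n F →ₗ[F] pn n F where
  toFun x := ⟨(rhoGL g : Mat n F) * x * ((rhoGL g)⁻¹ : (Mat n F)ˣ), conj_mem g x⟩
  map_add' x y := by ext1; simp [mul_add, add_mul]
  map_smul' c x := by ext1; simp

theorem Ad_even (g : GL (Fin n) F) {x : pn n F} (hx : x ∈ even n F) : Ad g x ∈ even n F := by
  obtain ⟨X, hX⟩ := x
  obtain ⟨A, B, C, D, rfl⟩ : ∃ A B C D, X = Matrix.fromBlocks A B C D :=
    ⟨_, _, _, _, (Matrix.fromBlocks_toBlocks X).symm⟩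
  obtain ⟨rfl, rfl⟩ : B = 0 ∧ C = 0 := hx
  show ((rhoGL g : Mat n F) * _ * ((rhoGL g)⁻¹ : (Mat n F)ˣ) : Mat n F).toBlocks₁₂ = 0 ∧
    ((rhoGL g : Mat n F) * _ * ((rhoGL g)⁻¹ : (Mat n F)ˣ) : Mat n F).toBlocks₂₁ = 0
  rw [conj_fromBlocks]; simp

theorem Ad_odd (g : GL (Fin n) F) {x : pn n F} (hx : x ∈ odd n F) : Ad g x ∈ odd n F := by
  obtain ⟨X, hX⟩ := x
  obtain ⟨A, B, C, D, rfl⟩ : ∃ A B C D, X = Matrix.fromBlocks A B C D :=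
    ⟨_, _, _, _, (Matrix.fromBlocks_toBlocks X).symm⟩
  obtain ⟨rfl, rfl⟩ : A = 0 ∧ D = 0 := hx
  show ((rhoGL g : Mat n F) * _ * ((rhoGL g)⁻¹ : (Mat n F)ˣ) : Mat n F).toBlocks₁₁ = 0 ∧
    ((rhoGL g : Mat n F) * _ * ((rhoGL g)⁻¹ : (Mat n F)ˣ) : Mat n F).toBlocks₂₂ = 0
  rw [conj_fromBlocks]; simp

theorem Ad_degOne (g : GL (Fin n) F) {x : pn n F} (hx : x ∈ degOne n F) :
    Ad g x ∈ degOne n F := by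
  refine ⟨Ad_odd g hx.1, ?_⟩
  obtain ⟨X, hX⟩ := x
  obtain ⟨A, B, C, D, rfl⟩ : ∃ A B C D, X = Matrix.fromBlocks A B C D :=
    ⟨_, _, _, _, (Matrix.fromBlocks_toBlocks X).symm⟩
  obtain rfl : C = 0 := hx.2
  show ((rhoGL g : Mat n F) * _ * ((rhoGL g)⁻¹ : (Mat n F)ˣ) : Mat n F).toBlocks₂₁ = 0
  rw [conj_fromBlocks]; simp

/-- The action of `G` on `U(𝔤)` by algebra homomorphisms extending `Ad`. -/
noncomputable def actU (g : GL (Fin n) F) : U n F →ₐ[F] U n F :=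
  RingQuot.liftAlgHom F ⟨TensorAlgebra.lift F (ιU n F ∘ₗ Ad g), by
    intro a b hab
    cases hab with
    | comm x y hx hy =>
      have := mkU_rel (EnvRel.comm (Ad g x) (Ad g y) (Ad_even g hx)
        (hy.imp (Ad_even g) (Ad_odd g)))
      simp only [map_sub, map_mul, TensorAlgebra.lift_ι_apply] at this ⊢
      refine this.trans (congrArg (ιU n F) (Subtype.ext ?_))
      simp [Ad, mul_sub, sub_mul, mul_assoc]
    | anticomm x y hx hy =>
      have := mkU_rel (EnvRel.anticomm (Ad g x) (Ad g y) (Ad_odd g hx)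
        (Ad_odd g hy))
      simp only [map_add, map_mul, TensorAlgebra.lift_ι_apply] at this ⊢
      refine this.trans (congrArg (ιU n F) (Subtype.ext ?_))
      simp [Ad, mul_add, add_mul, mul_assoc]⟩

theorem actU_ι (g : GL (Fin n) F) (x : pn n F) : actU g (ιU n F x) = ιU n F (Ad g x) := by
  refine (RingQuot.liftAlgHom_mkAlgHom_apply F _ _ _).trans ?_
  rw [TensorAlgebra.lift_ι_apply]
  rfl

variable (p : ℕ) [Fact p.Prime] [CharP F p]

/-- The action of `G` on `u(𝔤)`. -/
noncomputable def actu (g : GL (Fin n) F) : u n F p →ₐ[F] u n F p :=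
  RingQuot.liftAlgHom F ⟨(mku n F p).comp (actU g), by
    intro a b hab
    cases hab with
    | pow x hx =>
      have := mku_rel p (ResRel.pow (p := p) (Ad g x) (Ad_even g hx))
      simp only [AlgHom.comp_apply, map_pow, actU_ι] at this ⊢
      refine this.trans (congrArg (ιu n F p) (Subtype.ext ?_))
      exact Units.conj_pow (rhoGL g) (x : Mat n F) p⟩

theorem actu_ι (g : GL (Fin n) F) (x : pn n F) : actu p g (ιu n F p x) = ιu n F p (Ad g x) := by
  refine (RingQuot.liftAlgHom_mkAlgHom_apply F _ _ _).trans ?_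
  rw [AlgHom.comp_apply, actU_ι]
  rfl

/-- The action of `G` on `ū`. -/
noncomputable def act (g : GL (Fin n) F) : ubar n F p →ₐ[F] ubar n F p :=
  RingQuot.liftAlgHom F ⟨(mkubar n F p).comp (actu p g), by
    intro a b hab
    cases hab with
    | prod l hl hd =>
      have := mkubar_rel p (NilRel.prod (p := p) (l.map (Ad g))
        (by
          intro x hx
          obtain ⟨y, hy, rfl⟩ := List.mem_map.1 hx
          exact Ad_degOne g (hl y hy)) (by simpa using hd))
      rw [map_zero] at this
      rw [AlgHom.comp_apply, map_zero, ← this, map_list_prod, List.map_map, List.map_map]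
      congr 3
      funext x
      exact actu_ι p g x⟩

theorem act_ι (g : GL (Fin n) F) (x : pn n F) : act p g (ι n F p x) = ι n F p (Ad g x) := by
  refine (RingQuot.liftAlgHom_mkAlgHom_apply F _ _ _).trans ?_
  rw [AlgHom.comp_apply, actu_ι]
  rfl

/-- The element `diag(t_1, …, t_n)` of the maximal torus `T` of `G`. -/
def torus (t : Fin n → Fˣ) : GL (Fin n) F where
  val := Matrix.diagonal fun i => (t i : F)
  inv := Matrix.diagonal fun i => ((t i)⁻¹ : Fˣ)
  val_inv := by simp [Matrix.diagonal_mul_diagonal]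
  inv_val := by simp [Matrix.diagonal_mul_diagonal]

end GroupAction

section HarishChandra

/-- Evaluation of a commutative polynomial at a commuting family in an algebra. -/
noncomputable def evalComm {n : ℕ} {F : Type*} [Field F] {A : Type*} [Ring A] [Algebra F A]
    (a : Fin n → A) (h : ∀ i j, a i * a j = a j * a i) : MvPolynomial (Fin n) F →ₐ[F] A :=
  letI : CommRing (Algebra.adjoin F (Set.range a)) :=
    { (inferInstance : Ring (Algebra.adjoin F (Set.range a))) with
      mul_comm := (Algebra.isMulCommutative_adjoin F (by
        rintro _ ⟨i, rfl⟩ _ ⟨j, rfl⟩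
        exact h i j)).is_comm.comm }
  (Algebra.adjoin F (Set.range a)).val.comp
    (MvPolynomial.aeval fun i => (⟨a i, Algebra.subset_adjoin ⟨i, rfl⟩⟩ :
      Algebra.adjoin F (Set.range a)))

theorem evalComm_X {n : ℕ} {F : Type*} [Field F] {A : Type*} [Ring A] [Algebra F A]
    (a : Fin n → A) (h : ∀ i j, a i * a j = a j * a i) (i : Fin n) :
    evalComm (F := F) a h (MvPolynomial.X i) = a i := by
  simp [evalComm]

variable (n : ℕ) (F : Type*) [Field F] (p : ℕ) [Fact p.Prime] [CharP F p]

/-- The central subalgebra `𝒵 = {z ∈ ū_0̄ : g z = z for all g ∈ G, [z, 𝔤_1̄] = 0}`. As `z` is even,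
its superbracket with any element is the commutator. -/
noncomputable def Z : Subalgebra F (ubar n F p) :=
  ubarEven n F p ⊓ (⨅ g : GL (Fin n) F, AlgHom.equalizer (act p g) (AlgHom.id F (ubar n F p))) ⊓
    Subalgebra.centralizer F (ι n F p '' (odd n F : Set (pn n F)))

/-- The algebra `ū^T` of invariants of the torus `T`. -/
noncomputable def ubarT : Subalgebra F (ubar n F p) :=
  ⨅ t : Fin n → Fˣ, AlgHom.equalizer (act p (torus t)) (AlgHom.id F (ubar n F p))

/-- `𝔩 = ū 𝔫⁺ ∩ ū^T`, where `ū 𝔫⁺` is the left ideal generated by `𝔫⁺`. -/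
noncomputable def lIdeal : Submodule F (ubar n F p) :=
  (Ideal.span (ι n F p '' (nPlus n F : Set (pn n F)))).restrictScalars F ⊓
    Subalgebra.toSubmodule (ubarT n F p)

/-- The ideal of `U(𝔥) = S(𝔥) = F[h_1, …, h_n]` generated by the `h_i ^ p - h_i`. -/
noncomputable def uhIdeal : Ideal (MvPolynomial (Fin n) F) :=
  Ideal.span (Set.range fun i => MvPolynomial.X i ^ p - MvPolynomial.X i)

/-- The restricted enveloping algebra `u(𝔥)` of the torus `𝔥` with basis `h_1, …, h_n`,
`h_i^{[p]} = h_i`. -/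
abbrev uh := MvPolynomial (Fin n) F ⧸ uhIdeal n F p

variable {n} in
/-- The element `h_i = e_{i,i} - e_{n+i,n+i}` of `𝔤`. -/
def hElt (i : Fin n) : pn n F :=
  ⟨Matrix.fromBlocks (Matrix.diagonal (Pi.single i 1)) 0 0
    (-Matrix.diagonal (Pi.single i 1)), mem_pn_fromBlocks.2 (by simp)⟩

variable {n} in
theorem hElt_even (i : Fin n) : hElt F i ∈ even n F := ⟨rfl, rfl⟩

theorem hElt_commute (i j : Fin n) :
    ι n F p (hElt F i) * ι n F p (hElt F j) = ι n F p (hElt F j) * ι n F p (hElt F i) := by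
  have h := mkU_rel (EnvRel.comm (hElt F i) (hElt F j) (hElt_even F i)
    (Or.inl (hElt_even F j)))
  have h0 : (⟨(hElt F i : Mat n F) * hElt F j - hElt F j * hElt F i,
      comm_mem _ _ (hElt_even F i) (Or.inl (hElt_even F j))⟩ : pn n F) = 0 := by
    ext1
    refine sub_eq_zero.2 ?_
    simp only [hElt, Matrix.fromBlocks_multiply]
    simp [Matrix.diagonal_mul_diagonal, mul_comm]
  rw [h0, map_zero, map_zero, map_sub, map_mul, map_mul, sub_eq_zero] at h
  have h2 := congrArg (fun a => mkubar n F p (mku n F p a)) h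
  simp only [map_mul] at h2
  exact h2

theorem hElt_pow (i : Fin n) : ι n F p (hElt F i) ^ p = ι n F p (hElt F i) := by
  have h := mku_rel p (ResRel.pow (p := p) (hElt F i) (hElt_even F i))
  have h0 : (⟨(hElt F i : Mat n F) ^ p, pow_mem p _ (hElt_even F i)⟩ : pn n F) = hElt F i := by
    ext1
    have hp : p ≠ 0 := (Fact.out : p.Prime).ne_zero
    have key : ∀ k : ℕ, (hElt F i : Mat n F) ^ (k + 1) =
        Matrix.fromBlocks (Matrix.diagonal (Pi.single i 1)) 0 0
          (Matrix.diagonal (Pi.single i ((-1 : F) ^ (k + 1)))) := by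
      intro k
      induction k with
      | zero => simp [hElt, Matrix.diagonal_neg, Pi.single_neg]
      | succ k ih =>
        rw [pow_succ, ih]
        simp only [hElt, Matrix.fromBlocks_multiply, Matrix.diagonal_neg]
        simp only [Matrix.diagonal_mul_diagonal, Matrix.mul_zero, Matrix.zero_mul, add_zero,
          zero_add, pow_succ]
        congr 2 <;> funext j <;> by_cases hj : j = i
        · subst hj; simp
        · simp [hj]
        · subst hj; simp
        · simp [hj]
    obtain ⟨k, hk⟩ := Nat.exists_eq_succ_of_ne_zero hp
    show (hElt F i : Mat n F) ^ p = hElt F i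
    rw [hk, key, ← Nat.succ_eq_add_one, ← hk, neg_one_pow_char F p]
    simp [hElt, Matrix.diagonal_neg, Pi.single_neg]
  rw [h0] at h
  rw [map_pow] at h
  have h2 := congrArg (mkubar n F p) h
  rw [map_pow] at h2
  exact h2

/-- The canonical algebra homomorphism `F[h_1, …, h_n] → ū`. -/
noncomputable def polyToUbar : MvPolynomial (Fin n) F →ₐ[F] ubar n F p :=
  evalComm (fun i => ι n F p (hElt F i)) (hElt_commute n F p)

theorem polyToUbar_X (i : Fin n) : polyToUbar n F p (MvPolynomial.X i) = ι n F p (hElt F i) := by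
  exact evalComm_X _ _ i

/-- The canonical algebra homomorphism `u(𝔥) → ū`, sending the generator `h_i` of `u(𝔥)` to the
class of `h_i ∈ 𝔤`. -/
noncomputable def uhToUbar : uh n F p →ₐ[F] ubar n F p :=
  Ideal.Quotient.liftₐ (uhIdeal n F p) (polyToUbar n F p) (by
    intro a ha
    have : uhIdeal n F p ≤ RingHom.ker (polyToUbar n F p) := by
      refine Ideal.span_le.2 ?_
      rintro _ ⟨i, rfl⟩
      show polyToUbar n F p _ = 0
      rw [map_sub, map_pow, polyToUbar_X, hElt_pow, sub_self]
    exact this ha)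

theorem uhToUbar_h (i : Fin n) :
    uhToUbar n F p (Ideal.Quotient.mk _ (MvPolynomial.X i)) = ι n F p (hElt F i) :=
  polyToUbar_X n F p i

variable {n F} in
/-- `f` is the image of `v ∈ ū^T` under the Harish-Chandra projection `ū^T = u(𝔥) ⊕ 𝔩 → u(𝔥)`
with kernel `𝔩`. -/
def IsHCImage (v : ubar n F p) (f : uh n F p) : Prop :=
  v ∈ ubarT n F p ∧ v - uhToUbar n F p f ∈ lIdeal n F p

/-- The image `h(𝒵)` of `𝒵` under the Harish-Chandra projection. -/
def hcZ : Set (uh n F p) := {f | ∃ z ∈ Z n F p, IsHCImage p z f}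

end HarishChandra

section DotAction

variable {n : ℕ} {F : Type*} [Field F]

/-- The coordinates `ρ(h_i)` of an element `ρ ∈ 𝔥*` with `ρ(h_i - h_{i+1}) = 1` for all `i`. -/
def rho (i : Fin n) : F := -(i.val : F)

/-- The dot action `w · λ = w (λ + ρ) - ρ` of `W = S_n` on `𝔥*`, in the coordinates
`λ_i = λ(h_i)`; here `w ε_k = ε_{w k}`. -/
def dotWeight (w : Equiv.Perm (Fin n)) (l : Fin n → F) (i : Fin n) : F :=
  l (w⁻¹ i) + rho (w⁻¹ i) - rho i

/-- The dot action of `W` on `U(𝔥) = F[h_1, …, h_n]`, as an algebra homomorphism; it is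
characterised by `(w · f)(λ) = f(w⁻¹ · λ)`. -/
noncomputable def dotPoly (w : Equiv.Perm (Fin n)) :
    MvPolynomial (Fin n) F →ₐ[F] MvPolynomial (Fin n) F :=
  MvPolynomial.aeval fun i => MvPolynomial.X (w i) + MvPolynomial.C (rho (w i) - rho i)

theorem eval_dotPoly (w : Equiv.Perm (Fin n)) (f : MvPolynomial (Fin n) F) (l : Fin n → F) :
    MvPolynomial.eval l (dotPoly w f) = MvPolynomial.eval (dotWeight w⁻¹ l) f := by
  induction f using MvPolynomial.induction_on with
  | C a => simp [dotPoly]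
  | add f g hf hg => simp [hf, hg]
  | mul_X f i hf =>
    rw [map_mul, map_mul, hf, map_mul]
    simp [dotPoly, dotWeight]
    ring_nf
    try simp

variable (p : ℕ) [Fact p.Prime] [CharP F p]

/-- The dot action of `W` on `u(𝔥)`. -/
noncomputable def dot (w : Equiv.Perm (Fin n)) : uh n F p →ₐ[F] uh n F p :=
  Ideal.quotientMapₐ (uhIdeal n F p) (dotPoly w) (by
    refine Ideal.span_le.2 ?_
    rintro _ ⟨i, rfl⟩
    show dotPoly w _ ∈ uhIdeal n F p
    have hc : ((rho (w i) - rho i : F)) ^ p = rho (w i) - rho i := by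
      have : (rho (w i) - rho i : F) = ((-(w i).val + i.val : ℤ) : F) := by
        simp [rho]
      rw [this]
      have h := congrArg (ZMod.castHom (dvd_refl p) F) (ZMod.pow_card ((-(w i).val + i.val : ℤ) : ZMod p))
      simpa only [map_pow, map_intCast] using h
    have h2 : dotPoly w (MvPolynomial.X i ^ p - MvPolynomial.X i : MvPolynomial (Fin n) F) =
        MvPolynomial.X (w i) ^ p - MvPolynomial.X (w i) := by
      simp only [dotPoly, map_sub, map_pow, MvPolynomial.aeval_X]
      rw [add_pow_char, ← map_sub, ← map_pow, hc]
      ring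
    rw [h2]
    exact Ideal.subset_span ⟨w i, rfl⟩)

variable (n F) in
/-- The invariants `u(𝔥)^{W·}` of the dot action. -/
noncomputable def uhInv : Subalgebra F (uh n F p) :=
  ⨅ w : Equiv.Perm (Fin n), AlgHom.equalizer (dot p w) (AlgHom.id F (uh n F p))

variable (n F) in
/-- `Θ = ∏_{i ≠ j} ((h_i - h_j)(μ + ρ) - 1) ∈ U(𝔥)`, as a polynomial function of `μ ∈ 𝔥*`. -/
noncomputable def thetaPoly : MvPolynomial (Fin n) F :=
  ∏ ij ∈ (Finset.univ : Finset (Fin n)).offDiag,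
    (MvPolynomial.X ij.1 - MvPolynomial.X ij.2 + MvPolynomial.C (rho ij.1 - rho ij.2) - 1)

theorem eval_thetaPoly (μ : Fin n → F) : MvPolynomial.eval μ (thetaPoly n F) =
    ∏ ij ∈ (Finset.univ : Finset (Fin n)).offDiag,
      ((μ ij.1 + rho ij.1) - (μ ij.2 + rho ij.2) - 1) := by
  rw [thetaPoly, map_prod]
  refine Finset.prod_congr rfl fun ij _ => ?_
  simp
  ring

variable (n F) in
/-- The image of `Θ` in `u(𝔥)`. -/
noncomputable def theta : uh n F p := Ideal.Quotient.mk _ (thetaPoly n F)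

end DotAction

end Periplectic

/-! An element of u(𝔥) is the same thing as a function on F_p^n (`uh_ext`, `exists_evalUh_eq`), so
the theorem is a statement about the values of f = h(z). These values are visible in modules: if v
has weight a and is killed by 𝔫⁺, then z v = f(a) v (`nilAction_singular`).

The modules are Fock spaces ⋀(V₀ ⊗ F^S) ⊗ S(V₁ ⊗ F^S), with V₀ ⊕ V₁ the natural module of 𝔤𝔩(n|n);
u(𝔤) acts on them through bilinear expressions in creation and annihilation operators. A product of
fermions filling top-justified columns is a highest weight vector, and as the number of columns of
each height is arbitrary, every weight in F_p^n occurs. A vector killed by 𝔤_1 generates a submodule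
killed by I: the submodule is the sum of the spaces ⋀^k 𝔤_{-1} M^{𝔤_1}, these vanish for k > d, and
𝔤_1 lowers k by one (`layer_zero_le_nilPart`). So ū acts there.

Two moves connect highest weight vectors and force equalities between values of f. An element of 𝒵
commutes with the lowering operators e_{ji}, which are brackets of odd elements; by the 𝔰𝔩₂
computation a suitable power of a simple lowering operator takes weight a to s·a, and f is invariant
under the dot action (`evalUh_dotWeight`). It also commutes with the vector c of 𝔤_{-1} of weight
-ε_{n-1} - ε_n; if the last two coordinates of a agree, c takes a suitable highest weight vector to
one of weight a - ε_{n-1} - ε_n (`exists_isSingular_cElt`). In the coordinates l = a + ρ this says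
that f, now symmetric, does not change when a pair (x + 1, x) slides to (x, x - 1). Sliding and
permuting connect all points having such a pair, and these points are the zeros of Θ
(`eq_of_symmetric_of_shift`). Hence f is a constant c on the zeros of Θ, and f - c is divisible by Θ
pointwise, with an invariant quotient (`exists_eq_theta_mul_add`).

The projection is unique because a function whose image lies in 𝔩 vanishes at every weight. It
exists because ū is spanned modulo ū 𝔫⁺ by words in negative root vectors times u(𝔥), and a
one-parameter subgroup of T separates the nonempty words from the invariants. -/

namespace Periplectic

/-! ### Fock spaces of several copies of the natural module. -/

section Fock

open scoped TensorProduct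

variable {n : ℕ} {S : Type*} {F : Type*} [Field F]

/-- The sign rule: the creation and annihilation operators with index `inl i` are fermionic, those
with index `inr i` bosonic. -/
def sg : Fin n ⊕ Fin n → Fin n ⊕ Fin n → F
  | .inl _, .inl _ => -1
  | _, _ => 1

/-- The eigenvalues of the parity operator on the natural module. -/
def tau : Fin n ⊕ Fin n → F
  | .inl _ => -1
  | .inr _ => 1

variable (n S F) in
/-- A module over the creation and annihilation operators of `V ⊗ F^S`, with `V` the natural module
of `𝔤𝔩(n|n)`, generated by a vacuum vector. -/
structure Oscillator [DecidableEq S] (M : Type*) [AddCommGroup M] [Module F M] where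
  /-- The vacuum vector. -/
  vac : M
  /-- The creation operators. -/
  cr : Fin n ⊕ Fin n → S → Module.End F M
  /-- The annihilation operators. -/
  an : Fin n ⊕ Fin n → S → Module.End F M
  vac_ne_zero : vac ≠ 0
  an_vac : ∀ α s, an α s vac = 0
  an_cr : ∀ α β s t m,
    an α s (cr β t m) = (sg α β : F) • cr β t (an α s m) + (if α = β ∧ s = t then m else 0)
  cr_cr : ∀ α β s t m, cr α s (cr β t m) = (sg α β : F) • cr β t (cr α s m)
  cr_inl_sq : ∀ i s m, cr (.inl i) s (cr (.inl i) s m) = 0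
  induction : ∀ K : Submodule F M, vac ∈ K → (∀ α s, ∀ m ∈ K, cr α s m ∈ K) → K = ⊤

variable (n S F) in
/-- The superspace `⋀(V₀ ⊗ F^S) ⊗ S(V₁ ⊗ F^S)`, where `V₀ ⊕ V₁` is the natural module of
`𝔤𝔩(n|n)`. -/
abbrev Fock := ExteriorAlgebra F (Fin n × S → F) ⊗[F] MvPolynomial (Fin n × S) F

variable (n S F) in
/-- The vacuum vector. -/
noncomputable def vacuum : Fock n S F := 1 ⊗ₜ 1

/-- The annihilation operators. -/
noncomputable def annihilation : Fin n ⊕ Fin n → S → Module.End F (Fock n S F)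
  | .inl i, s => LinearMap.rTensor _
      (CliffordAlgebra.contractLeft (Q := (0 : QuadraticForm F (Fin n × S → F)))
        (LinearMap.proj (i, s)))
  | .inr i, s => LinearMap.lTensor _ (MvPolynomial.pderiv (i, s)).toLinearMap

theorem annihilation_vacuum (α : Fin n ⊕ Fin n) (s : S) : annihilation α s (vacuum n S F) = 0 := by
  rcases α with i | i
  · show _ ⊗ₜ _ = _
    rw [CliffordAlgebra.contractLeft_one, TensorProduct.zero_tmul]
  · show _ ⊗ₜ _ = _
    simp

theorem vacuum_ne_zero : vacuum n S F ≠ 0 := by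
  intro h
  have h2 := congrArg (TensorProduct.map (ExteriorAlgebra.algebraMapInv (R := F)).toLinearMap
    (MvPolynomial.aeval (fun _ => (0 : F))).toLinearMap) h
  rw [vacuum, TensorProduct.map_tmul, map_zero] at h2
  simpa using congrArg (TensorProduct.lid F F) h2

variable [DecidableEq S]

/-- The creation operators. -/
noncomputable def creation : Fin n ⊕ Fin n → S → Module.End F (Fock n S F)
  | .inl i, s => LinearMap.rTensor _
      (LinearMap.mulLeft F (ExteriorAlgebra.ι F (Pi.single (i, s) (1 : F))))
  | .inr i, s => LinearMap.lTensor _ (LinearMap.mulLeft F (MvPolynomial.X (i, s)))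

/-- Contraction is an antiderivation of the exterior algebra and `pderiv` a derivation of the
polynomial ring. Operators on different tensor factors commute without a sign, which is why `sg` is
1 on mixed pairs. -/
theorem annihilation_creation (α β : Fin n ⊕ Fin n) (s t : S) (m : Fock n S F) :
    annihilation α s (creation β t m) =
      (sg α β : F) • creation β t (annihilation α s m) + (if α = β ∧ s = t then m else 0) := by
  induction m using TensorProduct.induction_on with
  | zero => simp
  | add x y hx hy =>
    simp only [map_add, hx, hy, smul_add]
    split_ifs <;> abel
  | tmul x y =>
    rcases α with i | i <;> rcases β with j | j
    · simp only [annihilation, creation, LinearMap.rTensor_tmul, LinearMap.mulLeft_apply, sg]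
      erw [CliffordAlgebra.contractLeft_ι_mul]
      rw [TensorProduct.sub_tmul, sub_eq_neg_add]
      refine congrArg₂ (· + ·) (neg_one_smul F _).symm ?_
      by_cases h : i = j ∧ s = t
      · simp [h]
      · have h' : ¬ ((i, s) = (j, t)) := by simpa using h
        simp [h, h']
    · simp [annihilation, creation, sg]
    · simp [annihilation, creation, sg]
    · simp only [annihilation, creation, LinearMap.lTensor_tmul, LinearMap.mulLeft_apply, sg,
        one_smul,
        Derivation.coeFn_coe, Derivation.leibniz, MvPolynomial.pderiv_X, TensorProduct.tmul_add,
        smul_eq_mul]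
      congr 1
      by_cases h : i = j ∧ s = t
      · simp [h]
      · have h' : ¬ ((j, t) = (i, s)) := by
          rintro h'; simp only [Prod.mk.injEq] at h'; exact h ⟨h'.1.symm, h'.2.symm⟩
        simp [h, h']

theorem creation_creation (α β : Fin n ⊕ Fin n) (s t : S) (m : Fock n S F) :
    creation α s (creation β t m) = (sg α β : F) • creation β t (creation α s m) := by
  induction m using TensorProduct.induction_on with
  | zero => simp
  | add x y hx hy => simp only [map_add, hx, hy, smul_add]
  | tmul x y =>
    rcases α with i | i <;> rcases β with j | j
    · simp only [creation, LinearMap.rTensor_tmul, LinearMap.mulLeft_apply, sg, ← mul_assoc]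
      refine Eq.trans ?_ (TensorProduct.smul_tmul' (-1 : F) _ _).symm
      refine congrArg (· ⊗ₜ y) (Eq.trans ?_ (neg_one_smul F _).symm)
      rw [← neg_mul]
      congr 1
      exact eq_neg_of_add_eq_zero_left (ExteriorAlgebra.ι_add_mul_swap _ _)
    · simp [creation, sg]
    · simp [creation, sg]
    · simp [creation, sg, mul_left_comm]

theorem creation_inl_sq (i : Fin n) (s : S) (m : Fock n S F) :
    creation (F := F) (.inl i) s (creation (.inl i) s m) = 0 := by
  induction m using TensorProduct.induction_on with
  | zero => simp
  | add x y hx hy => simp only [map_add, hx, hy, add_zero]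
  | tmul x y =>
    simp only [creation, LinearMap.rTensor_tmul, LinearMap.mulLeft_apply, ← mul_assoc]
    simp

variable [Fintype S]

theorem fock_induction (K : Submodule F (Fock n S F)) (h0 : vacuum n S F ∈ K)
    (h1 : ∀ α s, ∀ m ∈ K, creation α s m ∈ K) : K = ⊤ := by
  have hy : ∀ y : MvPolynomial (Fin n × S) F,
      ((1 : ExteriorAlgebra F (Fin n × S → F)) ⊗ₜ[F] y) ∈ K := by
    intro y
    induction y using MvPolynomial.induction_on with
    | C a =>
      rw [show (MvPolynomial.C a : MvPolynomial (Fin n × S) F) = a • 1 by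
        simp [MvPolynomial.smul_eq_C_mul], TensorProduct.tmul_smul]
      exact K.smul_mem _ h0
    | add p q hp hq => rw [TensorProduct.tmul_add]; exact K.add_mem hp hq
    | mul_X p i hp =>
      have := h1 (.inr i.1) i.2 _ hp
      simpa [creation, mul_comm] using this
  refine (Submodule.eq_top_iff').2 fun m => ?_
  induction m using TensorProduct.induction_on with
  | zero => exact K.zero_mem
  | add x y hx hy => exact K.add_mem hx hy
  | tmul x y =>
    induction x using CliffordAlgebra.left_induction with
    | algebraMap r =>
      rw [Algebra.algebraMap_eq_smul_one, ← TensorProduct.smul_tmul']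
      exact K.smul_mem _ (hy y)
    | add a b ha hb => rw [TensorProduct.add_tmul]; exact K.add_mem ha hb
    | ι_mul a v ha =>
      have hv : v = ∑ k : Fin n × S, v k • Pi.single k (1 : F) := by
        ext j
        simp [Finset.sum_apply, Pi.single_apply]
      rw [hv, map_sum, Finset.sum_mul, TensorProduct.sum_tmul]
      refine K.sum_mem fun k _ => ?_
      rw [map_smul, smul_mul_assoc, ← TensorProduct.smul_tmul']
      exact K.smul_mem _ (h1 (.inl k.1) k.2 _ ha)

variable (n S F) in
/-- The Fock space. -/
noncomputable def fock : Oscillator n S F (Fock n S F) where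
  vac := vacuum n S F
  cr := creation
  an := annihilation
  vac_ne_zero := vacuum_ne_zero
  an_vac := annihilation_vacuum
  an_cr := annihilation_creation
  cr_cr := creation_creation
  cr_inl_sq := creation_inl_sq
  induction := fock_induction

end Fock

/-! ### Bilinear operators and the action of 𝔤𝔩(n|n). -/

namespace Oscillator

variable {n : ℕ} {S : Type*} {F : Type*} [Field F] [DecidableEq S] {M : Type*}
  [AddCommGroup M] [Module F M] (O : Oscillator n S F M)

/-- An operator that commutes with the creation operators up to scalars and kills the vacuum is
zero. -/
theorem end_eq_zero (Q : Module.End F M) (π : Fin n ⊕ Fin n → F)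
    (h0 : Q O.vac = 0) (h1 : ∀ α s m, Q (O.cr α s m) = π α • O.cr α s (Q m)) : Q = 0 := by
  rw [← LinearMap.ker_eq_top]
  refine O.induction _ h0 fun α s m hm => ?_
  rw [LinearMap.mem_ker] at hm ⊢
  rw [h1, hm, map_zero, smul_zero]

variable [Fintype S]

/-- The action of `𝔤𝔩(n|n)` on an oscillator module. -/
noncomputable def op : Mat n F →ₗ[F] Module.End F M where
  toFun X := ∑ s, ∑ α, ∑ β, X β α • (O.cr β s * O.an α s)
  map_add' X Y := by simp [add_smul, Finset.sum_add_distrib]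
  map_smul' c X := by simp [mul_smul, Finset.smul_sum]

theorem op_apply (X : Mat n F) (m : M) :
    O.op X m = ∑ s, ∑ α, ∑ β, X β α • O.cr β s (O.an α s m) := by
  simp [op, LinearMap.sum_apply]

theorem op_vac (X : Mat n F) : O.op X O.vac = 0 := by
  simp [O.op_apply, O.an_vac]

/-- `X` is homogeneous, and passes the vectors of the natural module with the signs `π`. -/
def IsPar (π : Fin n ⊕ Fin n → F) (X : Mat n F) : Prop :=
  ∀ α β γ, X β α * (sg α γ * sg β γ) = π γ * X β α

/-- `op X` is a superderivation for which the creation operators of each copy transform as the basis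
of the natural module; the extra sum is the contribution of the pairing of `an γ t` with `cr γ t`.
-/
theorem op_cr {π : Fin n ⊕ Fin n → F} {X : Mat n F} (hX : IsPar π X) (γ : Fin n ⊕ Fin n)
    (t : S) (m : M) :
    O.op X (O.cr γ t m) = π γ • O.cr γ t (O.op X m) + ∑ β, X β γ • O.cr β t m := by
  have h1 : ∀ s α β, X β α • O.cr β s (O.an α s (O.cr γ t m)) =
      π γ • X β α • O.cr γ t (O.cr β s (O.an α s m)) +
        (if α = γ then if s = t then X β γ • O.cr β t m else 0 else 0) := by
    intro s α β
    rw [O.an_cr, map_add, map_smul, O.cr_cr β γ, smul_smul, smul_add, smul_smul, smul_smul,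
      ← hX α β γ]
    congr 1
    by_cases h : α = γ
    · by_cases h' : s = t
      · simp [h, h']
      · simp [h, h']
    · simp [h]
  simp only [O.op_apply, h1, Finset.sum_add_distrib]
  congr 1
  · simp only [map_sum, Finset.smul_sum, map_smul]
  · rw [Finset.sum_eq_single t, Finset.sum_eq_single γ]
    · simp
    · intro α _ h; simp [h]
    · simp
    · intro s _ h; simp [h]
    · simp

/-- Both sides kill the vacuum and have the same supercommutators with the creation operators, so
`end_eq_zero` applies to their difference. Here ε is the sign of the superbracket, and `hXY`, `hYX`
say that X and Y change the signs π' and π by ε, which cancels the mixed terms. -/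
theorem op_bracket {π π' : Fin n ⊕ Fin n → F} {X Y : Mat n F} {ε : F} (hX : IsPar π X)
    (hY : IsPar π' Y) (hXY : ∀ β γ, π' γ * X β γ = ε * (π' β * X β γ))
    (hYX : ∀ β γ, π β * Y β γ = ε * (π γ * Y β γ))
    (hZ : IsPar (fun γ => π γ * π' γ) (X * Y - ε • (Y * X))) :
    O.op X * O.op Y - ε • (O.op Y * O.op X) = O.op (X * Y - ε • (Y * X)) := by
  rw [← sub_eq_zero]
  refine O.end_eq_zero _ (fun γ => π γ * π' γ) (by simp [O.op_vac]) fun γ s m => ?_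
  have e1 : ∑ β, X β γ • π' γ • O.cr β s (O.op Y m) =
      ε • ∑ β, X β γ • π' β • O.cr β s (O.op Y m) := by
    rw [Finset.smul_sum]
    refine Finset.sum_congr rfl fun β _ => ?_
    rw [smul_smul, smul_smul, smul_smul, mul_comm, hXY]
    congr 1
    ring
  have e2 : ∑ β, Y β γ • π β • O.cr β s (O.op X m) =
      ε • ∑ β, Y β γ • π γ • O.cr β s (O.op X m) := by
    rw [Finset.smul_sum]
    refine Finset.sum_congr rfl fun β _ => ?_
    rw [smul_smul, smul_smul, smul_smul, mul_comm, hYX]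
    congr 1
    ring
  have e3 : ∀ A B : Mat n F, ∑ β, (A * B) β γ • O.cr β s m =
      ∑ β, B β γ • ∑ δ, A δ β • O.cr δ s m := by
    intro A B
    simp only [Matrix.mul_apply, Finset.sum_smul, Finset.smul_sum]
    rw [Finset.sum_comm]
    refine Finset.sum_congr rfl fun _ _ => Finset.sum_congr rfl fun _ _ => ?_
    rw [smul_smul, mul_comm]
  have e4 : ∑ β, (X * Y - ε • (Y * X)) β γ • O.cr β s m =
      ∑ β, Y β γ • ∑ δ, X δ β • O.cr δ s m - ε • ∑ β, X β γ • ∑ δ, Y δ β • O.cr δ s m := by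
    rw [← e3, ← e3, Finset.smul_sum, ← Finset.sum_sub_distrib]
    refine Finset.sum_congr rfl fun β _ => ?_
    simp only [Matrix.sub_apply, Matrix.smul_apply, smul_eq_mul, sub_smul, mul_smul]
  simp only [LinearMap.sub_apply, LinearMap.smul_apply, Module.End.mul_apply]
  rw [O.op_cr hZ, O.op_cr hX, O.op_cr hY, e4]
  simp only [map_add, map_sum, map_smul, O.op_cr hX, O.op_cr hY, smul_add, smul_sub,
    Finset.sum_add_distrib, map_sub]
  have e1' : π' γ • ∑ β, X β γ • O.cr β s (O.op Y m) =
      ε • ∑ β, X β γ • π' β • O.cr β s (O.op Y m) := by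
    rw [← e1, Finset.smul_sum]
    exact Finset.sum_congr rfl fun _ _ => smul_comm _ _ _
  have e2' : ε • π γ • ∑ β, Y β γ • O.cr β s (O.op X m) =
      ∑ β, Y β γ • π β • O.cr β s (O.op X m) := by
    rw [e2, Finset.smul_sum]
    congr 1
    exact Finset.sum_congr rfl fun _ _ => smul_comm _ _ _
  rw [e1', e2', smul_smul (π γ) (π' γ), smul_smul (π γ * π' γ) ε, smul_smul (π' γ) (π γ),
    smul_smul ε, mul_comm (π' γ) (π γ), mul_comm ε]
  abel

end Oscillator

/-! ### Restriction of the action to p(n) and to u(𝔤). -/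

section Parity

variable {n : ℕ} {F : Type*} [Field F]

theorem even_apply {x : pn n F} (hx : x ∈ even n F) (i j : Fin n) :
    (x : Mat n F) (.inl i) (.inr j) = 0 ∧ (x : Mat n F) (.inr i) (.inl j) = 0 :=
  ⟨congrFun₂ hx.1 i j, congrFun₂ hx.2 i j⟩

theorem odd_apply {x : pn n F} (hx : x ∈ odd n F) (i j : Fin n) :
    (x : Mat n F) (.inl i) (.inl j) = 0 ∧ (x : Mat n F) (.inr i) (.inr j) = 0 :=
  ⟨congrFun₂ hx.1 i j, congrFun₂ hx.2 i j⟩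

theorem isPar_one {X : Mat n F} (h : ∀ i j, X (.inl i) (.inr j) = 0 ∧ X (.inr i) (.inl j) = 0) :
    Oscillator.IsPar 1 X := by
  rintro (i | i) (j | j) (k | k) <;> simp [sg, h]

theorem isPar_tau {X : Mat n F} (h : ∀ i j, X (.inl i) (.inl j) = 0 ∧ X (.inr i) (.inr j) = 0) :
    Oscillator.IsPar tau X := by
  rintro (i | i) (j | j) (k | k) <;> simp [sg, h, tau]

theorem isPar_even {x : pn n F} (hx : x ∈ even n F) : Oscillator.IsPar 1 (x : Mat n F) :=
  isPar_one (even_apply hx)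

theorem isPar_odd {x : pn n F} (hx : x ∈ odd n F) : Oscillator.IsPar tau (x : Mat n F) :=
  isPar_tau (odd_apply hx)

end Parity

namespace Oscillator

variable {n : ℕ} {S : Type*} {F : Type*} [Field F] [DecidableEq S] {M : Type*}
  [AddCommGroup M] [Module F M] (O : Oscillator n S F M) [Fintype S]

theorem op_comm (x y : pn n F) (hx : x ∈ even n F) (hy : y ∈ even n F ∨ y ∈ odd n F) :
    O.op x * O.op y - O.op y * O.op x = O.op ((x : Mat n F) * y - y * x) := by
  have hx' := even_apply hx
  rcases hy with hy | hy
  · have hy' := even_apply hy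
    have := O.op_bracket (ε := 1) (isPar_even hx) (isPar_even hy) (by simp) (by simp)
      (by
        rw [show (fun γ => (1 : Fin n ⊕ Fin n → F) γ * (1 : Fin n ⊕ Fin n → F) γ) = 1 by
          ext; simp]
        refine isPar_one fun i j => ?_
        simp [Matrix.mul_apply, hx', hy'])
    simpa using this
  · have hy' := odd_apply hy
    have := O.op_bracket (ε := 1) (isPar_even hx) (isPar_odd hy)
      (by rintro (i | i) (j | j) <;> simp [tau, hx']) (by simp)
      (by
        rw [show (fun γ => (1 : Fin n ⊕ Fin n → F) γ * tau γ) = tau by ext; simp]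
        refine isPar_tau fun i j => ?_
        simp [Matrix.mul_apply, hx', hy'])
    simpa using this

theorem op_anticomm (x y : pn n F) (hx : x ∈ odd n F) (hy : y ∈ odd n F) :
    O.op x * O.op y + O.op y * O.op x = O.op ((x : Mat n F) * y + y * x) := by
  have hx' := odd_apply hx
  have hy' := odd_apply hy
  have := O.op_bracket (ε := -1) (isPar_odd hx) (isPar_odd hy)
    (by rintro (i | i) (j | j) <;> simp [tau, hx'])
    (by rintro (i | i) (j | j) <;> simp [tau, hy'])
    (by
      rw [show (fun γ => tau γ * tau γ) = (1 : Fin n ⊕ Fin n → F) by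
        ext γ; rcases γ with i | i <;> simp [tau]]
      refine isPar_one fun i j => ?_
      simp [Matrix.mul_apply, hx', hy'])
  simpa using this

/-- In characteristic p, ad(T)^p = ad(T^p), because left and right multiplication commute. On the
creation operators ad(`op X`) is the matrix X, so its p-th power is X^p, which is also ad(`op (X ^
p)`). The difference of the two operators thus commutes with all creation operators and kills the
vacuum. -/
theorem op_pow (p : ℕ) [Fact p.Prime] [CharP F p] {X : Mat n F}
    (h : ∀ i j, X (.inl i) (.inr j) = 0 ∧ X (.inr i) (.inl j) = 0) :
    O.op X ^ p = O.op (X ^ p) := by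
  have hp : p ≠ 0 := (Fact.out : p.Prime).ne_zero
  have hpow : ∀ k : ℕ, ∀ i j, (X ^ k) (.inl i) (.inr j) = 0 ∧ (X ^ k) (.inr i) (.inl j) = 0 := by
    intro k
    induction k with
    | zero => intro i j; simp
    | succ k ih => intro i j; simp [pow_succ, Matrix.mul_apply, ih, h]
  have key : ∀ Y : Mat n F, (∀ i j, Y (.inl i) (.inr j) = 0 ∧ Y (.inr i) (.inl j) = 0) →
      ∀ t v, (LinearMap.mulLeft F (O.op Y) - LinearMap.mulRight F (O.op Y))
        (∑ γ, v γ • O.cr γ t) = ∑ γ, (Y.mulVec v) γ • O.cr γ t := by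
    intro Y hY t v
    ext m
    simp only [LinearMap.sub_apply, LinearMap.mulLeft_apply, LinearMap.mulRight_apply,
      Module.End.mul_apply, LinearMap.sum_apply, LinearMap.smul_apply, map_sum, map_smul,
      O.op_cr (isPar_one hY), Pi.one_apply, one_smul,
      add_sub_cancel_left, Matrix.mulVec, dotProduct, Finset.sum_smul, Finset.smul_sum]
    rw [Finset.sum_comm]
    refine Finset.sum_congr rfl fun _ _ => Finset.sum_congr rfl fun _ _ => ?_
    rw [smul_smul, mul_comm]
  have key2 : ∀ k : ℕ, ∀ t v,
      ((LinearMap.mulLeft F (O.op X) - LinearMap.mulRight F (O.op X)) ^ k)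
        (∑ γ, v γ • O.cr γ t) = ∑ γ, ((X ^ k).mulVec v) γ • O.cr γ t := by
    intro k t
    induction k with
    | zero => simp
    | succ k ih =>
      intro v
      rw [pow_succ, Module.End.mul_apply, key X h, ih, Matrix.mulVec_mulVec, pow_succ]
  have : Nontrivial M := ⟨_, _, O.vac_ne_zero⟩
  have : CharP (Module.End F (Module.End F M)) p :=
    charP_of_injective_algebraMap (algebraMap F (Module.End F (Module.End F M))).injective p
  rw [← sub_eq_zero]
  refine O.end_eq_zero _ 1 ?_ fun γ t m => ?_
  · obtain ⟨k, rfl⟩ := Nat.exists_eq_succ_of_ne_zero hp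
    simp [pow_succ, O.op_vac]
  · have h1 := key2 p t (Pi.single γ 1)
    rw [sub_pow_char_of_commute p (LinearMap.commute_mulLeft_right _ _),
      LinearMap.pow_mulLeft, LinearMap.pow_mulRight,
      ← key (X ^ p) (hpow p)] at h1
    have h2 : ∑ β, (Pi.single γ (1 : F) : Fin n ⊕ Fin n → F) β • O.cr β t = O.cr γ t := by
      simp [Pi.single_apply, Finset.sum_ite_eq']
    rw [h2] at h1
    have h3 := congrArg (fun f : Module.End F M => f m) h1
    simp only [LinearMap.sub_apply, LinearMap.mulLeft_apply, LinearMap.mulRight_apply,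
      Module.End.mul_apply] at h3
    simp only [LinearMap.sub_apply, Pi.one_apply, one_smul, map_sub]
    rw [sub_eq_sub_iff_add_eq_add] at h3 ⊢
    rw [h3, add_comm]

/-- The action of `U(𝔤)` on an oscillator module. -/
noncomputable def actionU : U n F →ₐ[F] Module.End F M :=
  RingQuot.liftAlgHom F ⟨TensorAlgebra.lift F (O.op ∘ₗ (pn n F).subtype), by
    intro a b hab
    cases hab with
    | comm x y hx hy =>
      simp only [map_sub, map_mul, TensorAlgebra.lift_ι_apply]
      exact O.op_comm x y hx hy
    | anticomm x y hx hy =>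
      simp only [map_add, map_mul, TensorAlgebra.lift_ι_apply]
      exact O.op_anticomm x y hx hy⟩

theorem actionU_ι (x : pn n F) : O.actionU (ιU n F x) = O.op x := by
  refine (RingQuot.liftAlgHom_mkAlgHom_apply F _ _ _).trans ?_
  rw [TensorAlgebra.lift_ι_apply]
  rfl

variable (p : ℕ) [Fact p.Prime] [CharP F p]

/-- The action of `u(𝔤)` on an oscillator module. -/
noncomputable def action : u n F p →ₐ[F] Module.End F M :=
  RingQuot.liftAlgHom F ⟨O.actionU, by
    intro a b hab
    cases hab with
    | pow x hx =>
      rw [map_pow, actionU_ι, actionU_ι]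
      exact O.op_pow p (even_apply hx)⟩

theorem action_ι (x : pn n F) : O.action p (ιu n F p x) = O.op x := by
  refine (RingQuot.liftAlgHom_mkAlgHom_apply F _ _ _).trans ?_
  exact O.actionU_ι x

end Oscillator

/-! ### Generators and brackets in u(𝔤) and ū. -/

section Relations

variable {n : ℕ} {F : Type*} [Field F] (p : ℕ) [Fact p.Prime] [CharP F p]

theorem ιu_comm (x y : pn n F) (hx : x ∈ even n F) (hy : y ∈ even n F ∨ y ∈ odd n F) :
    ιu n F p x * ιu n F p y = ιu n F p y * ιu n F p x +
      ιu n F p ⟨(x : Mat n F) * y - y * x, comm_mem x y hx hy⟩ := by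
  have h := congrArg (mku n F p) (mkU_rel (EnvRel.comm x y hx hy))
  simp only [map_sub, map_mul] at h
  exact sub_eq_iff_eq_add'.1 h

theorem ιu_anticomm (x y : pn n F) (hx : x ∈ odd n F) (hy : y ∈ odd n F) :
    ιu n F p x * ιu n F p y = -(ιu n F p y * ιu n F p x) +
      ιu n F p ⟨(x : Mat n F) * y + y * x, anticomm_mem x y hx hy⟩ := by
  have h := congrArg (mku n F p) (mkU_rel (EnvRel.anticomm x y hx hy))
  simp only [map_add, map_mul] at h
  rw [neg_add_eq_sub]
  exact eq_sub_of_add_eq h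

theorem ι_comm (x y : pn n F) (hx : x ∈ even n F) (hy : y ∈ even n F ∨ y ∈ odd n F) :
    ι n F p x * ι n F p y = ι n F p y * ι n F p x +
      ι n F p ⟨(x : Mat n F) * y - y * x, comm_mem x y hx hy⟩ := by
  have h := congrArg (mkubar n F p) (ιu_comm p x y hx hy)
  simp only [map_add, map_mul] at h
  exact h

theorem ι_anticomm (x y : pn n F) (hx : x ∈ odd n F) (hy : y ∈ odd n F) :
    ι n F p x * ι n F p y = -(ι n F p y * ι n F p x) +
      ι n F p ⟨(x : Mat n F) * y + y * x, anticomm_mem x y hx hy⟩ := by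
  have h := congrArg (mkubar n F p) (ιu_anticomm p x y hx hy)
  simp only [map_add, map_mul, map_neg] at h
  exact h

theorem u_induction {C : u n F p → Prop} (algebraMap : ∀ r, C (algebraMap F _ r))
    (ι : ∀ x, C (ιu n F p x)) (mul : ∀ a b, C a → C b → C (a * b))
    (add : ∀ a b, C a → C b → C (a + b)) (a : u n F p) : C a := by
  obtain ⟨a, rfl⟩ := RingQuot.mkAlgHom_surjective F (ResRel n F p) a
  obtain ⟨a, rfl⟩ := RingQuot.mkAlgHom_surjective F (EnvRel n F) a
  induction a using TensorAlgebra.induction with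
  | algebraMap r => rw [AlgHom.commutes]; erw [AlgHom.commutes]; exact algebraMap r
  | ι x => exact ι x
  | mul a b ha hb => rw [map_mul]; erw [map_mul]; exact mul _ _ ha hb
  | add a b ha hb => rw [map_add]; erw [map_add]; exact add _ _ ha hb

theorem ubar_induction {C : ubar n F p → Prop} (algebraMap : ∀ r, C (algebraMap F _ r))
    (ι : ∀ x, C (ι n F p x)) (mul : ∀ a b, C a → C b → C (a * b))
    (add : ∀ a b, C a → C b → C (a + b)) (a : ubar n F p) : C a := by
  obtain ⟨a, rfl⟩ : ∃ b, mkubar n F p b = a := RingQuot.mkAlgHom_surjective F (NilRel n F p) a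
  induction a using u_induction with
  | algebraMap r => rw [AlgHom.commutes]; exact algebraMap r
  | ι x => exact ι x
  | mul a b ha hb => rw [map_mul]; exact mul _ _ ha hb
  | add a b ha hb => rw [map_add]; exact add _ _ ha hb

/-- The element of `𝔤_0̄` with upper left block `A`. -/
def aElt (A : Matrix (Fin n) (Fin n) F) : pn n F :=
  ⟨Matrix.fromBlocks A 0 0 (-A.transpose), mem_pn_fromBlocks.2 (by simp)⟩

/-- The element of `𝔤_1` with upper right block `B`. -/
def bElt (B : Matrix (Fin n) (Fin n) F) (hB : B.transpose = B) : pn n F :=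
  ⟨Matrix.fromBlocks 0 B 0 0, mem_pn_fromBlocks.2 (by simp [hB])⟩

/-- The element of `𝔤_{-1}` with lower left block `C`. -/
def cElt (C : Matrix (Fin n) (Fin n) F) (hC : C.transpose = -C) : pn n F :=
  ⟨Matrix.fromBlocks 0 0 C 0, mem_pn_fromBlocks.2 (by simp [hC])⟩

variable (n F) in
/-- The component `𝔤_{-1}` of the `ℤ`-grading: matrices with `a = 0` and `b = 0`. -/
def degNeg : Submodule F (pn n F) where
  carrier := {x | x ∈ odd n F ∧ (x : Mat n F).toBlocks₁₂ = 0}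
  zero_mem' := ⟨(odd n F).zero_mem, rfl⟩
  add_mem' := by
    rintro x y ⟨h1, h2⟩ ⟨k1, k2⟩
    exact ⟨(odd n F).add_mem h1 k1, (congrArg₂ (· + ·) h2 k2).trans (add_zero 0)⟩
  smul_mem' := by
    rintro c x ⟨h1, h2⟩
    exact ⟨(odd n F).smul_mem c h1, (congrArg (c • ·) h2).trans (smul_zero c)⟩

theorem aElt_even (A : Matrix (Fin n) (Fin n) F) : aElt A ∈ even n F := ⟨rfl, rfl⟩

theorem bElt_mem (B : Matrix (Fin n) (Fin n) F) (hB) : bElt B hB ∈ degOne n F :=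
  ⟨⟨rfl, rfl⟩, rfl⟩

theorem cElt_mem (C : Matrix (Fin n) (Fin n) F) (hC) : cElt C hC ∈ degNeg n F :=
  ⟨⟨rfl, rfl⟩, rfl⟩

theorem exists_decomp (x : pn n F) :
    ∃ A B hB C hC, x = aElt A + bElt B hB + cElt C hC := by
  obtain ⟨X, hX⟩ := x
  obtain ⟨A, B, C, D, rfl⟩ : ∃ A B C D, X = Matrix.fromBlocks A B C D :=
    ⟨_, _, _, _, (Matrix.fromBlocks_toBlocks X).symm⟩
  obtain ⟨h1, h2, h3⟩ := mem_pn_fromBlocks.1 hX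
  refine ⟨A, B, h2, C, h3, Subtype.ext ?_⟩
  simp [aElt, bElt, cElt, Matrix.fromBlocks_add, h1]

theorem exists_eq_bElt {x : pn n F} (hx : x ∈ degOne n F) : ∃ B hB, x = bElt B hB := by
  obtain ⟨X, hX⟩ := x
  obtain ⟨A, B, C, D, rfl⟩ : ∃ A B C D, X = Matrix.fromBlocks A B C D :=
    ⟨_, _, _, _, (Matrix.fromBlocks_toBlocks X).symm⟩
  obtain ⟨⟨rfl, rfl⟩, rfl⟩ : (A = 0 ∧ D = 0) ∧ C = 0 := hx
  obtain ⟨h1, h2, h3⟩ := mem_pn_fromBlocks.1 hX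
  exact ⟨B, h2, rfl⟩

theorem exists_eq_cElt {x : pn n F} (hx : x ∈ degNeg n F) : ∃ C hC, x = cElt C hC := by
  obtain ⟨X, hX⟩ := x
  obtain ⟨A, B, C, D, rfl⟩ : ∃ A B C D, X = Matrix.fromBlocks A B C D :=
    ⟨_, _, _, _, (Matrix.fromBlocks_toBlocks X).symm⟩
  obtain ⟨⟨rfl, rfl⟩, rfl⟩ : (A = 0 ∧ D = 0) ∧ B = 0 := hx
  obtain ⟨h1, h2, h3⟩ := mem_pn_fromBlocks.1 hX
  exact ⟨C, h3, rfl⟩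

section Brackets

variable {p}
variable {R : Type*} [Ring R] [Algebra F R] (g : u n F p →ₐ[F] R)

/-- The brackets are taken under an arbitrary algebra map `g` out of u(𝔤), so that they serve both
for representations and, with `g` equal to `mkubar`, for ū. -/
theorem bracket_aa (A A' : Matrix (Fin n) (Fin n) F) :
    g (ιu n F p (aElt A)) * g (ιu n F p (aElt A')) =
      g (ιu n F p (aElt A')) * g (ιu n F p (aElt A)) +
        g (ιu n F p (aElt (A * A' - A' * A))) := by
  rw [← map_mul g, ← map_mul g, ← map_add g,
    ιu_comm p _ _ (aElt_even A) (Or.inl (aElt_even A'))]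
  congr 4
  simp [aElt, Matrix.fromBlocks_multiply, sub_eq_add_neg, Matrix.fromBlocks_neg,
    Matrix.fromBlocks_add, add_comm]

theorem bracket_ab_symm (A : Matrix (Fin n) (Fin n) F) {B : Matrix (Fin n) (Fin n) F}
    (hB : B.transpose = B) :
    (A * B + B * A.transpose).transpose = A * B + B * A.transpose := by
  simp [hB, add_comm]

theorem bracket_ab (A B : Matrix (Fin n) (Fin n) F) (hB : B.transpose = B) :
    g (ιu n F p (aElt A)) * g (ιu n F p (bElt B hB)) =
      g (ιu n F p (bElt B hB)) * g (ιu n F p (aElt A)) +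
        g (ιu n F p (bElt (A * B + B * A.transpose) (bracket_ab_symm A hB))) := by
  rw [← map_mul g, ← map_mul g, ← map_add g,
    ιu_comm p _ _ (aElt_even A) (Or.inr (bElt_mem B hB).1)]
  congr 4
  simp [aElt, bElt, Matrix.fromBlocks_multiply, sub_eq_add_neg, Matrix.fromBlocks_neg,
    Matrix.fromBlocks_add]

theorem bracket_ac_skew (A : Matrix (Fin n) (Fin n) F) {C : Matrix (Fin n) (Fin n) F}
    (hC : C.transpose = -C) :
    (-(A.transpose * C) - C * A).transpose = -(-(A.transpose * C) - C * A) := by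
  simp [hC]

theorem bracket_ac (A C : Matrix (Fin n) (Fin n) F) (hC : C.transpose = -C) :
    g (ιu n F p (aElt A)) * g (ιu n F p (cElt C hC)) =
      g (ιu n F p (cElt C hC)) * g (ιu n F p (aElt A)) +
        g (ιu n F p (cElt (-(A.transpose * C) - C * A) (bracket_ac_skew A hC))) := by
  rw [← map_mul g, ← map_mul g, ← map_add g,
    ιu_comm p _ _ (aElt_even A) (Or.inr (cElt_mem C hC).1)]
  congr 4
  simp [aElt, cElt, Matrix.fromBlocks_multiply, sub_eq_add_neg, Matrix.fromBlocks_neg,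
    Matrix.fromBlocks_add]

theorem bracket_bc (B : Matrix (Fin n) (Fin n) F) (hB : B.transpose = B)
    (C : Matrix (Fin n) (Fin n) F) (hC : C.transpose = -C) :
    g (ιu n F p (bElt B hB)) * g (ιu n F p (cElt C hC)) =
      -(g (ιu n F p (cElt C hC)) * g (ιu n F p (bElt B hB))) +
        g (ιu n F p (aElt (B * C))) := by
  rw [← map_mul g, ← map_mul g, ← map_neg g, ← map_add g,
    ιu_anticomm p _ _ (bElt_mem B hB).1 (cElt_mem C hC).1]
  congr 4
  simp [bElt, cElt, Matrix.fromBlocks_multiply, Matrix.fromBlocks_add, hB, hC]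

theorem bracket_cc (C : Matrix (Fin n) (Fin n) F) (hC : C.transpose = -C)
    (C' : Matrix (Fin n) (Fin n) F) (hC' : C'.transpose = -C') :
    g (ιu n F p (cElt C hC)) * g (ιu n F p (cElt C' hC')) =
      -(g (ιu n F p (cElt C' hC')) * g (ιu n F p (cElt C hC))) := by
  rw [← map_mul g, ← map_mul g, ← map_neg g,
    ιu_anticomm p _ _ (cElt_mem C hC).1 (cElt_mem C' hC').1, map_add]
  convert add_zero _
  convert map_zero g
  convert map_zero (ιu n F p)
  simp [cElt, Matrix.fromBlocks_multiply]

end Brackets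

end Relations

/-! ### Modules over ū: vectors killed by 𝔤_1. -/

section Restriction

variable {n : ℕ} {F : Type*} [Field F] {p : ℕ} [Fact p.Prime] [CharP F p]

theorem two_ne_zero_of_char (hp : p ≠ 2) : (2 : F) ≠ 0 := by
  intro h
  have := (CharP.cast_eq_zero_iff F p 2).1 (by exact_mod_cast h)
  exact hp ((Nat.prime_dvd_prime_iff_eq Fact.out Nat.prime_two).1 this)

/-- A skew-symmetric matrix is determined by its entries above the diagonal, the diagonal being zero
as the characteristic is not 2. -/
theorem finrank_degNeg_le (hp : p ≠ 2) : Module.finrank F (degNeg n F) ≤ n * (n - 1) / 2 := by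
  have h2 : (2 : F) ≠ 0 := two_ne_zero_of_char hp
  let f : degNeg n F →ₗ[F] ((Σ j : Fin n, Fin j) → F) :=
    { toFun := fun x k => ((x : pn n F) : Mat n F) (.inr ⟨k.2, k.2.2.trans k.1.2⟩) (.inl k.1)
      map_add' := fun _ _ => rfl
      map_smul' := fun _ _ => rfl }
  have hf : Function.Injective f := by
    rw [injective_iff_map_eq_zero]
    rintro ⟨x, hx⟩ h
    obtain ⟨C, hC, rfl⟩ := exists_eq_cElt hx
    have hlt : ∀ i j : Fin n, i < j → C i j = 0 := fun i j hij =>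
      congrFun h ⟨j, ⟨i, hij⟩⟩
    have hs : ∀ i j, C j i = - C i j := fun i j => congrFun₂ hC i j
    have hC0 : C = 0 := by
      ext i j
      rcases lt_trichotomy i j with hij | rfl | hij
      · exact hlt i j hij
      · have := hs i i
        rw [eq_neg_iff_add_eq_zero, ← two_mul] at this
        exact (mul_eq_zero.1 this).resolve_left h2
      · rw [hs, hlt j i hij]; simp
    subst hC0
    refine Subtype.ext (Subtype.ext ?_)
    show Matrix.fromBlocks _ _ _ _ = _
    simp
  refine (LinearMap.finrank_le_finrank_of_injective hf).trans ?_
  rw [Module.finrank_pi, Fintype.card_sigma]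
  simp only [Fintype.card_fin]
  rw [Fin.sum_univ_eq_sum_range (fun i => i), Finset.sum_range_id]

/-- A linear map with squares zero extends to the exterior algebra of V, whose degrees above dim V
vanish. -/
theorem prod_ofFn_eq_zero {V A : Type*} [AddCommGroup V] [Module F V] [Module.Finite F V] [Ring A]
    [Algebra F A] (f : V →ₗ[F] A) (hf : ∀ c, f c * f c = 0) {k : ℕ} (hk : Module.finrank F V < k)
    (v : Fin k → V) : (List.ofFn fun i => f (v i)).prod = 0 := by
  have h : ExteriorAlgebra.ιMulti F k v = 0 := by
    refine AlternatingMap.map_linearDependent _ _ fun hv => ?_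
    have := hv.fintype_card_le_finrank
    rw [Fintype.card_fin] at this
    omega
  have h2 := congrArg (ExteriorAlgebra.lift F ⟨f, hf⟩) h
  rw [map_zero, ExteriorAlgebra.ιMulti_apply, map_list_prod, List.map_ofFn] at h2
  rw [← h2]
  congr 2
  funext i
  exact (ExteriorAlgebra.lift_ι_apply F f hf (v i)).symm

variable {M : Type*} [AddCommGroup M] [Module F M] (Φ : u n F p →ₐ[F] Module.End F M)

/-- The subspaces `⋀^k 𝔤_{-1} M^{𝔤_1}` of a `u(𝔤)`-module `M`. -/
noncomputable def layer : ℕ → Submodule F M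
  | 0 => ⨅ b : degOne n F, LinearMap.ker (Φ (ιu n F p b))
  | k + 1 => Submodule.span F {m | ∃ c ∈ degNeg n F, ∃ w ∈ layer k, Φ (ιu n F p c) w = m}

theorem mem_layer_zero {m : M} :
    m ∈ layer Φ 0 ↔ ∀ b ∈ degOne n F, Φ (ιu n F p b) m = 0 := by
  simp [layer]

theorem layer_even (A : Matrix (Fin n) (Fin n) F) (k : ℕ) (m : M) (hm : m ∈ layer Φ k) :
    Φ (ιu n F p (aElt A)) m ∈ layer Φ k := by
  induction k generalizing m with
  | zero =>
    rw [mem_layer_zero] at hm ⊢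
    intro b hb
    obtain ⟨B, hB, rfl⟩ := exists_eq_bElt hb
    have h := congrArg (fun f : Module.End F M => f m) (bracket_ab Φ A B hB)
    simp only [LinearMap.add_apply, Module.End.mul_apply] at h
    rw [hm _ (bElt_mem _ _), hm _ (bElt_mem _ _), map_zero, add_zero] at h
    exact h.symm
  | succ k ih =>
    refine Submodule.span_induction (p := fun m _ => Φ (ιu n F p (aElt A)) m ∈ layer Φ (k + 1))
      ?_ (by simp) (fun x y _ _ hx hy => by rw [map_add]; exact add_mem hx hy)
      (fun r x _ hx => by rw [map_smul]; exact Submodule.smul_mem _ _ hx) hm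
    rintro _ ⟨c, hc, w, hw, rfl⟩
    obtain ⟨C, hC, rfl⟩ := exists_eq_cElt hc
    have h := congrArg (fun f : Module.End F M => f w) (bracket_ac Φ A C hC)
    simp only [LinearMap.add_apply, Module.End.mul_apply] at h
    rw [h]
    exact add_mem (Submodule.subset_span ⟨_, hc, _, ih w hw, rfl⟩)
      (Submodule.subset_span ⟨_, cElt_mem _ _, _, hw, rfl⟩)

theorem layer_degNeg {c : pn n F} (hc : c ∈ degNeg n F) (k : ℕ) (m : M) (hm : m ∈ layer Φ k) :
    Φ (ιu n F p c) m ∈ layer Φ (k + 1) :=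
  Submodule.subset_span ⟨_, hc, _, hm, rfl⟩

/-- From b c w = -c b w + [b, c] w with [b, c] in 𝔤_0̄, which preserves the layers. By induction c b
w returns to the layer of w, and it is zero at the bottom. -/
theorem layer_degOne (k : ℕ) {b : pn n F} (hb : b ∈ degOne n F) (m : M)
    (hm : m ∈ layer Φ (k + 1)) : Φ (ιu n F p b) m ∈ layer Φ k := by
  induction k generalizing m with
  | zero =>
    refine Submodule.span_induction (p := fun m _ => Φ (ιu n F p b) m ∈ layer Φ 0)
      ?_ (by simp) (fun x y _ _ hx hy => by rw [map_add]; exact add_mem hx hy)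
      (fun r x _ hx => by rw [map_smul]; exact Submodule.smul_mem _ _ hx) hm
    rintro _ ⟨c, hc, w, hw, rfl⟩
    obtain ⟨C, hC, rfl⟩ := exists_eq_cElt hc
    have hw' := (mem_layer_zero Φ).1 hw b hb
    obtain ⟨B, hB, rfl⟩ := exists_eq_bElt hb
    have h := congrArg (fun f : Module.End F M => f w) (bracket_bc Φ B hB C hC)
    simp only [LinearMap.add_apply, Module.End.mul_apply, LinearMap.neg_apply] at h
    rw [h, hw', map_zero, neg_zero, zero_add]
    exact layer_even Φ _ 0 w hw
  | succ k ih =>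
    refine Submodule.span_induction (p := fun m _ => Φ (ιu n F p b) m ∈ layer Φ (k + 1))
      ?_ (by simp) (fun x y _ _ hx hy => by rw [map_add]; exact add_mem hx hy)
      (fun r x _ hx => by rw [map_smul]; exact Submodule.smul_mem _ _ hx) hm
    rintro _ ⟨c, hc, w, hw, rfl⟩
    obtain ⟨C, hC, rfl⟩ := exists_eq_cElt hc
    have hw' := ih w hw
    obtain ⟨B, hB, rfl⟩ := exists_eq_bElt hb
    have h := congrArg (fun f : Module.End F M => f w) (bracket_bc Φ B hB C hC)
    simp only [LinearMap.add_apply, Module.End.mul_apply, LinearMap.neg_apply] at h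
    rw [h]
    exact add_mem (neg_mem (layer_degNeg Φ hc k _ hw')) (layer_even Φ _ (k + 1) w hw)

theorem degNeg_sq (hp : p ≠ 2) {c : pn n F} (hc : c ∈ degNeg n F) :
    Φ (ιu n F p c) * Φ (ιu n F p c) = 0 := by
  obtain ⟨C, hC, rfl⟩ := exists_eq_cElt hc
  have h := bracket_cc Φ C hC C hC
  rw [eq_neg_iff_add_eq_zero, ← two_smul F] at h
  exact (smul_eq_zero.1 h).resolve_left (two_ne_zero_of_char hp)

theorem layer_le_span (k : ℕ) :
    layer Φ k ≤ Submodule.span F {m | ∃ v : Fin k → degNeg n F,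
      ∃ w, (List.ofFn fun i => Φ (ιu n F p (v i))).prod w = m} := by
  induction k with
  | zero =>
    intro m _
    refine Submodule.subset_span ⟨Fin.elim0, m, ?_⟩
    simp
  | succ k ih =>
    refine Submodule.span_le.2 ?_
    rintro _ ⟨c, hc, w, hw, rfl⟩
    have hw' := ih hw
    refine Submodule.span_induction (p := fun w _ => Φ (ιu n F p c) w ∈ Submodule.span F
      {m | ∃ v : Fin (k + 1) → degNeg n F,
        ∃ w, (List.ofFn fun i => Φ (ιu n F p (v i))).prod w = m})
      ?_ (by simp) (fun x y _ _ hx hy => by rw [map_add]; exact add_mem hx hy)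
      (fun r x _ hx => by rw [map_smul]; exact Submodule.smul_mem _ _ hx) hw'
    rintro _ ⟨v, w, rfl⟩
    refine Submodule.subset_span ⟨Fin.cons ⟨c, hc⟩ v, w, ?_⟩
    rw [List.ofFn_succ, List.prod_cons, Module.End.mul_apply]
    rfl

theorem layer_eq_bot (hp : p ≠ 2) {k : ℕ} (hk : n * (n - 1) / 2 < k) : layer Φ k = ⊥ := by
  rw [eq_bot_iff]
  refine (layer_le_span Φ k).trans (Submodule.span_le.2 ?_)
  rintro _ ⟨v, w, rfl⟩
  have hfin : Module.finrank F (degNeg n F) < k := (finrank_degNeg_le hp).trans_lt hk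
  have h := prod_ofFn_eq_zero (V := degNeg n F) (A := Module.End F M)
    (Φ.toLinearMap ∘ₗ ιu n F p ∘ₗ (degNeg n F).subtype) (fun c => degNeg_sq Φ hp c.2) hfin v
  have h2 := congrArg (fun f : Module.End F M => f w) h
  exact (Submodule.mem_bot F).2 h2

/-- Each factor lowers the layer by one, and layer 0 is killed by 𝔤_1. -/
theorem layer_list (l : List (pn n F)) (hl : ∀ x ∈ l, x ∈ degOne n F) (k : ℕ)
    (hk : k < l.length) (m : M) (hm : m ∈ layer Φ k) : Φ (l.map (ιu n F p)).prod m = 0 := by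
  induction l using List.reverseRecOn generalizing k m with
  | nil => simp at hk
  | append_singleton l b ih =>
    rw [List.map_append, List.prod_append, map_mul, Module.End.mul_apply]
    simp only [List.map_cons, List.map_nil, List.prod_singleton]
    have hb := hl b (by simp)
    cases k with
    | zero => rw [(mem_layer_zero Φ).1 hm b hb, map_zero]
    | succ k =>
      exact ih (fun x hx => hl x (by simp [hx])) k (by simpa using hk) _
        (layer_degOne Φ k hb m hm)

/-- The largest `u(𝔤)`-submodule of `M` killed by the ideal `I`. -/
noncomputable def nilPart : Submodule F M :=
  ⨅ x : u n F p, ⨅ l : List (pn n F), ⨅ _ : (∀ x ∈ l, x ∈ degOne n F) ∧ n * (n - 1) / 2 < l.length,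
    LinearMap.ker (Φ ((l.map (ιu n F p)).prod * x))

theorem mem_nilPart {m : M} : m ∈ nilPart Φ ↔ ∀ x : u n F p, ∀ l : List (pn n F),
    (∀ x ∈ l, x ∈ degOne n F) → n * (n - 1) / 2 < l.length →
      Φ ((l.map (ιu n F p)).prod * x) m = 0 := by
  simp only [nilPart, Submodule.mem_iInf, LinearMap.mem_ker, and_imp]

theorem nilPart_stable (y : u n F p) (m : M) (hm : m ∈ nilPart Φ) : Φ y m ∈ nilPart Φ := by
  rw [mem_nilPart] at hm ⊢
  intro x l hl hd
  rw [← Module.End.mul_apply, ← map_mul, mul_assoc]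
  exact hm (x * y) l hl hd

/-- Vectors killed by `𝔤_1` generate submodules killed by `I`. -/
theorem layer_zero_le_nilPart (hp : p ≠ 2) : layer Φ 0 ≤ nilPart Φ := by
  intro m hm
  rw [mem_nilPart]
  -- The sum of the layers is a submodule: 𝔤_0̄ preserves the index, while 𝔤_1 and 𝔤_{-1} shift it
  -- down and up by one.
  have key : ∀ x : u n F p, ∀ w ∈ ⨆ k, layer Φ k, Φ x w ∈ ⨆ k, layer Φ k := by
    intro x
    induction x using u_induction with
    | algebraMap r =>
      intro w hw
      rw [AlgHom.commutes, Module.algebraMap_end_apply]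
      exact Submodule.smul_mem _ _ hw
    | mul a b ha hb =>
      intro w hw
      rw [map_mul]
      exact ha _ (hb _ hw)
    | add a b ha hb =>
      intro w hw
      rw [map_add]
      exact add_mem (ha _ hw) (hb _ hw)
    | ι x =>
      obtain ⟨A, B, hB, C, hC, rfl⟩ := exists_decomp x
      intro w hw
      refine Submodule.iSup_induction _
        (motive := fun w => Φ (ιu n F p (aElt A + bElt B hB + cElt C hC)) w ∈ ⨆ k, layer Φ k) hw
        ?_ (by simp) (fun x y hx hy => by rw [map_add]; exact add_mem hx hy)
      intro k w hw
      simp only [map_add, LinearMap.add_apply]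
      refine add_mem (add_mem ?_ ?_) ?_
      · exact Submodule.mem_iSup_of_mem k (layer_even Φ A k w hw)
      · cases k with
        | zero => rw [(mem_layer_zero Φ).1 hw _ (bElt_mem B hB)]; exact zero_mem _
        | succ k => exact Submodule.mem_iSup_of_mem k (layer_degOne Φ k (bElt_mem B hB) w hw)
      · exact Submodule.mem_iSup_of_mem (k + 1) (layer_degNeg Φ (cElt_mem C hC) k w hw)
  intro x l hl hd
  rw [map_mul, Module.End.mul_apply]
  refine Submodule.iSup_induction _ (motive := fun w => Φ (l.map (ιu n F p)).prod w = 0)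
    (key x m (Submodule.mem_iSup_of_mem 0 hm)) ?_ (by simp)
    (fun x y hx hy => by rw [map_add, hx, hy, add_zero])
  intro k w hw
  -- Either the product is long enough to leave through the bottom layer, or k exceeds d and the
  -- layer is already zero.
  by_cases hk : k < l.length
  · exact layer_list Φ l hl k hk w hw
  · rw [layer_eq_bot Φ hp (hd.trans_le (not_lt.1 hk)), Submodule.mem_bot] at hw
    rw [hw, map_zero]

/-- The action of `u(𝔤)` on `nilPart`. -/
noncomputable def nilActionAux : u n F p →ₐ[F] Module.End F (nilPart Φ) :=
  AlgHom.ofLinearMap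
    { toFun := fun y => (Φ y).restrict (nilPart_stable Φ y)
      map_add' := fun x y => by ext; simp
      map_smul' := fun c x => by ext; simp }
    (by ext; simp) (fun x y => by ext; simp)

/-- The action of `ū` on `nilPart`. -/
noncomputable def nilAction : ubar n F p →ₐ[F] Module.End F (nilPart Φ) :=
  RingQuot.liftAlgHom F ⟨nilActionAux Φ, by
    intro a b hab
    cases hab with
    | prod l hl hd =>
      ext m
      have := (mem_nilPart Φ).1 m.2 1 l hl hd
      rw [mul_one] at this
      rw [map_zero]
      exact this⟩

theorem nilAction_ι (x : pn n F) (m : nilPart Φ) :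
    (nilAction Φ (ι n F p x) m : M) = Φ (ιu n F p x) m := by
  have : nilAction Φ (ι n F p x) = nilActionAux Φ (ιu n F p x) :=
    RingQuot.liftAlgHom_mkAlgHom_apply F _ _ _
  rw [this]
  rfl

end Restriction

/-! ### Symmetric functions on F_p^n invariant under sliding a pair. -/

section Linkage

variable {n p : ℕ} [Fact p.Prime] {F : Type*}

theorem eq_of_forall_update {ι α β : Type*} [DecidableEq ι] [Fintype ι] (L : (ι → α) → β)
    (h : ∀ μ k x, L (Function.update μ k x) = L μ) (μ ν : ι → α) : L μ = L ν := by
  have key : ∀ s : Finset ι, L (fun k => if k ∈ s then ν k else μ k) = L μ := by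
    intro s
    induction s using Finset.induction_on with
    | empty => simp
    | insert k s hk ih =>
      rw [← ih, ← h (fun k => if k ∈ s then ν k else μ k) k (ν k)]
      congr 1
      funext j
      by_cases hj : j = k
      · subst hj; simp
      · simp [hj]
  simpa using (key Finset.univ).symm

theorem exists_perm_map_pair {ι : Type*} [DecidableEq ι] {i₀ j₀ i j : ι} (h₀ : i₀ ≠ j₀)
    (h : i ≠ j) : ∃ w : Equiv.Perm ι, w i₀ = i ∧ w j₀ = j := by
  -- The right factor takes i₀ to i; the left one corrects the image of j₀ to j and fixes i.
  refine ⟨Equiv.swap (Equiv.swap i₀ i j₀) j * Equiv.swap i₀ i, ?_, ?_⟩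
  · rw [Equiv.Perm.mul_apply, Equiv.swap_apply_left, Equiv.swap_apply_of_ne_of_ne _ h]
    intro hc
    apply h₀
    apply (Equiv.swap i₀ i).injective
    rw [← hc, Equiv.swap_apply_left]
  · rw [Equiv.Perm.mul_apply, Equiv.swap_apply_left]

/-- A nonzero element generates the additive group of ℤ/p. -/
theorem zmod_shift_induction {β : Type*} (K : ZMod p → β) (a : ZMod p) (ha : a ≠ 0)
    (h : ∀ x, K (x + a) = K x) (x y : ZMod p) : K x = K y := by
  have key : ∀ (m : ℕ) x, K (x + m * a) = K x := by
    intro m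
    induction m with
    | zero => simp
    | succ m ih =>
      intro x
      rw [Nat.cast_succ, add_mul, one_mul, ← add_assoc, h, ih]
  have h2 := key ((x - y) / a).val y
  rw [ZMod.natCast_zmod_val, div_mul_cancel₀ _ ha, add_sub_cancel] at h2
  exact h2

/-- A symmetric function on `F_p^n` that is unchanged when a pair of coordinates `a + 1, a` is
shifted to `a, a - 1` takes one value on the points with a pair of coordinates of this form. -/
theorem eq_of_symmetric_of_shift (hp : p ≠ 2) (G : (Fin n → ZMod p) → F)
    (hG : ∀ (w : Equiv.Perm (Fin n)) l, G (l ∘ w) = G l) {i₀ j₀ : Fin n} (h₀ : i₀ ≠ j₀)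
    (hs : ∀ l, l i₀ = l j₀ + 1 →
      G (Function.update (Function.update l i₀ (l j₀)) j₀ (l j₀ - 1)) = G l)
    {l l' : Fin n → ZMod p} {i j i' j' : Fin n} (hij : i ≠ j) (hl : l i = l j + 1)
    (hij' : i' ≠ j') (hl' : l' i' = l' j' + 1) : G l = G l' := by
  have h2 : (2 : ZMod p) ≠ 0 := two_ne_zero_of_char hp
  -- The pair (x + 1, x) overwrites the places i₀, j₀ of μ. By sliding, the value does not depend on
  -- x, so the pair can be brought next to any other coordinate.
  let K : ZMod p → (Fin n → ZMod p) → F := fun x μ =>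
    G (Function.update (Function.update μ i₀ (x + 1)) j₀ x)
  have hK : ∀ x y μ, K x μ = K y μ := by
    intro x y μ
    refine zmod_shift_induction (fun x => K x μ) 1 one_ne_zero (fun x => ?_) x y
    have := hs (Function.update (Function.update μ i₀ (x + 1 + 1)) j₀ (x + 1)) (by simp [h₀])
    show G _ = G _
    rw [← this]
    congr 1
    funext k
    by_cases hk : k = j₀
    · subst hk; simp
    · by_cases hk' : k = i₀
      · subst hk'; simp [hk]
      · simp [hk, hk']
  have hstep : ∀ μ k, k ≠ i₀ → k ≠ j₀ → K 0 (Function.update μ k (μ k + 2)) = K 0 μ := by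
    intro μ k hk hk'
    -- Put y = μ k. The pair (y + 1, y) beside y + 2 and the pair (y + 2, y + 1) beside y form the
    -- same triple, so a 3-cycle matches them: a coordinate outside the pair can be changed by 2.
    rw [hK 0 (μ k), hK 0 (μ k + 1) μ]
    show G _ = G _
    rw [← hG (Equiv.swap i₀ j₀ * Equiv.swap i₀ k)]
    congr 1
    funext m
    by_cases hm : m = j₀
    · subst hm
      rw [Function.comp_apply, Equiv.Perm.mul_apply,
        Equiv.swap_apply_of_ne_of_ne h₀.symm hk'.symm, Equiv.swap_apply_right]
      simp [h₀]
    by_cases hm' : m = i₀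
    · subst hm'
      rw [Function.comp_apply, Equiv.Perm.mul_apply, Equiv.swap_apply_left,
        Equiv.swap_apply_of_ne_of_ne hk hk']
      simp [h₀, hk, hk']
      ring
    by_cases hmk : m = k
    · subst hmk
      rw [Function.comp_apply, Equiv.Perm.mul_apply, Equiv.swap_apply_right,
        Equiv.swap_apply_left]
      simp [hk, hk']
    · rw [Function.comp_apply, Equiv.Perm.mul_apply, Equiv.swap_apply_of_ne_of_ne hm' hmk,
        Equiv.swap_apply_of_ne_of_ne hm' hm]
      simp [hm, hm', hmk]
  -- Coordinates at i₀ and j₀ are overwritten; the others move in steps of 2, which reach everything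
  -- since p is odd.
  have hconst : ∀ μ ν, K 0 μ = K 0 ν := by
    refine eq_of_forall_update (K 0) fun μ k x => ?_
    by_cases hk : k = i₀
    · subst hk
      show G _ = G _
      congr 1
      simp
    by_cases hk' : k = j₀
    · subst hk'
      show G _ = G _
      congr 1
      rw [Function.update_comm hk, Function.update_idem]
    rw [← Function.update_eq_self k μ, Function.update_idem]
    refine zmod_shift_induction (fun x => K 0 (Function.update μ k x)) 2 h2 (fun x => ?_) _ _
    have := hstep (Function.update μ k x) k hk hk'
    simpa using this
  have hfin : ∀ (l : Fin n → ZMod p) (i j : Fin n), i ≠ j → l i = l j + 1 → G l = K 0 0 := by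
    intro l i j hij hl
    obtain ⟨w, rfl, rfl⟩ := exists_perm_map_pair h₀ hij
    rw [← hG w, hconst 0 (l ∘ w), hK 0 (l (w j₀))]
    show G _ = G _
    congr 1
    rw [← hl]
    change _ = Function.update (Function.update (l ∘ w) i₀ ((l ∘ w) i₀)) j₀ ((l ∘ w) j₀)
    rw [Function.update_eq_self, Function.update_eq_self]
  rw [hfin l i j hij hl, hfin l' i' j' hij' hl']

end Linkage

/-! ### u(𝔥) as the algebra of functions on F_p^n. -/

section Functions

variable {n : ℕ} {F : Type*} [Field F] {p : ℕ} [Fact p.Prime] [CharP F p]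

variable (F) in
/-- A point of `F_p^n` as a point of `F^n`. -/
noncomputable def pt (a : Fin n → ZMod p) (i : Fin n) : F := ZMod.castHom (dvd_refl p) F (a i)

variable (F) in
/-- Evaluation of the elements of `u(𝔥)`, viewed as functions on `F_p^n`. -/
noncomputable def evalUh (a : Fin n → ZMod p) : uh n F p →ₐ[F] F :=
  Ideal.Quotient.liftₐ (uhIdeal n F p) (MvPolynomial.aeval (pt F a)) (by
    intro f hf
    have : uhIdeal n F p ≤ RingHom.ker (MvPolynomial.aeval (R := F) (pt F a)) := by
      refine Ideal.span_le.2 ?_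
      rintro _ ⟨i, rfl⟩
      show MvPolynomial.aeval _ _ = _
      rw [map_sub, map_pow, MvPolynomial.aeval_X, pt, ← map_pow, ZMod.pow_card, sub_self]
    exact this hf)

theorem evalUh_mk (a : Fin n → ZMod p) (f : MvPolynomial (Fin n) F) :
    evalUh F a (Ideal.Quotient.mk _ f) = MvPolynomial.eval (pt F a) f := by
  show MvPolynomial.aeval (pt F a) f = _
  rw [MvPolynomial.aeval_eq_eval]

/-- X^p - X splits over F_p with every element as a root. This identifies the generators of
`uhIdeal` with the vanishing polynomials of the grid F_p^n. -/
theorem prod_sub_castHom {R : Type*} [CommRing R] [Algebra F R] (x : R) :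
    ∏ r ∈ (Finset.univ : Finset (ZMod p)).map ⟨_, (ZMod.castHom (dvd_refl p) F).injective⟩,
      (x - algebraMap F R r) = x ^ p - x := by
  rw [Finset.prod_map]
  have hp := (Fact.out : p.Prime).one_lt
  have hdeg := FiniteField.X_pow_card_sub_X_natDegree_eq (ZMod p) hp
  have hroots : (Polynomial.X ^ p - Polynomial.X : Polynomial (ZMod p)).roots =
      Finset.univ.val := by
    have := FiniteField.roots_X_pow_card_sub_X (ZMod p)
    rwa [ZMod.card] at this
  have h := Polynomial.prod_multiset_X_sub_C_of_monic_of_roots_card_eq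
    (p := (Polynomial.X ^ p - Polynomial.X : Polynomial (ZMod p)))
    (Polynomial.monic_X_pow_sub (by rw [Polynomial.degree_X]; exact_mod_cast hp))
    (by rw [hdeg, hroots, Finset.card_val, Finset.card_univ, ZMod.card])
  rw [hroots] at h
  have h2 := congrArg
    (Polynomial.eval₂ ((algebraMap F R).comp (ZMod.castHom (dvd_refl p) F)) x) h
  simp only [Polynomial.eval₂_sub, Polynomial.eval₂_X_pow, Polynomial.eval₂_X] at h2
  rw [← h2]
  change _ = Polynomial.eval₂ _ x (∏ a : ZMod p, (Polynomial.X - Polynomial.C a))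
  rw [Polynomial.eval₂_finsetProd]
  simp

/-- By the combinatorial Nullstellensatz a polynomial vanishing on the grid F_p^n is a combination
of the X_i^p - X_i. -/
theorem uh_ext {f : uh n F p} (h : ∀ a, evalUh F a f = 0) : f = 0 := by
  obtain ⟨f, rfl⟩ := Ideal.Quotient.mk_surjective f
  rw [Ideal.Quotient.eq_zero_iff_mem]
  obtain ⟨g, -, hg⟩ := MvPolynomial.combinatorial_nullstellensatz_exists_linearCombination
    (fun _ : Fin n => (Finset.univ : Finset (ZMod p)).map
      ⟨_, (ZMod.castHom (dvd_refl p) F).injective⟩)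
    (fun _ => Finset.univ_nonempty.map) f (by
      intro x hx
      simp only [Finset.mem_map, Finset.mem_univ, true_and, Function.Embedding.coeFn_mk] at hx
      choose a ha using hx
      rw [show x = pt F a from funext fun i => (ha i).symm, ← evalUh_mk]
      exact h a)
  rw [hg, Finsupp.linearCombination_apply]
  refine Ideal.sum_mem _ fun i _ => Ideal.mul_mem_left _ _ (Ideal.subset_span ⟨i, ?_⟩)
  exact (prod_sub_castHom (MvPolynomial.X i)).symm

/-- Interpolation: by Fermat's little theorem, ∏ (1 - (X_i - b_i)^(p-1)) is the indicator function
of the point b. -/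
theorem exists_evalUh_eq (g : (Fin n → ZMod p) → F) : ∃ q : uh n F p, ∀ a, evalUh F a q = g a := by
  refine ⟨Ideal.Quotient.mk _ (∑ b, MvPolynomial.C (g b) *
    ∏ i, (1 - (MvPolynomial.X i - MvPolynomial.C (pt F b i)) ^ (p - 1))), fun a => ?_⟩
  rw [evalUh_mk, map_sum, Finset.sum_eq_single a]
  · have : p - 1 ≠ 0 := by have := (Fact.out : p.Prime).two_le; omega
    simp [map_prod, this]
  · intro b _ hb
    obtain ⟨i, hi⟩ : ∃ i, b i ≠ a i := by
      by_contra! h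
      exact hb (funext h)
    rw [map_mul, map_prod, Finset.prod_eq_zero (Finset.mem_univ i), mul_zero]
    simp only [map_sub, map_one, map_pow, MvPolynomial.eval_X, MvPolynomial.eval_C]
    rw [pt, pt, ← map_sub, ← map_pow, ZMod.pow_card_sub_one_eq_one (sub_ne_zero.2 hi.symm),
      map_one, sub_self]
  · simp

theorem pt_dotWeight (w : Equiv.Perm (Fin n)) (a : Fin n → ZMod p) :
    pt F (dotWeight w a) = dotWeight w (pt F a) := by
  funext i
  simp [pt, dotWeight, rho]

theorem evalUh_dot (w : Equiv.Perm (Fin n)) (a : Fin n → ZMod p) (f : uh n F p) :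
    evalUh F a (dot p w f) = evalUh F (dotWeight w⁻¹ a) f := by
  obtain ⟨f, rfl⟩ := Ideal.Quotient.mk_surjective f
  show evalUh F a (Ideal.Quotient.mk _ (dotPoly w f)) = _
  rw [evalUh_mk, evalUh_mk, eval_dotPoly, pt_dotWeight]

theorem mem_uhInv {q : uh n F p} (h : ∀ w a, evalUh F (dotWeight w a) q = evalUh F a q) :
    q ∈ uhInv n F p := by
  rw [uhInv, Algebra.mem_iInf]
  intro w
  show dot p w q = q
  rw [← sub_eq_zero]
  refine uh_ext fun a => ?_
  rw [map_sub, evalUh_dot, h, sub_self]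

theorem evalUh_theta (a : Fin n → ZMod p) :
    evalUh F a (theta n F p) = ∏ ij ∈ (Finset.univ : Finset (Fin n)).offDiag,
      ((pt F a ij.1 + rho ij.1) - (pt F a ij.2 + rho ij.2) - 1) := by
  rw [theta, evalUh_mk, eval_thetaPoly]

theorem dotWeight_add_rho {K : Type*} [Field K] (w : Equiv.Perm (Fin n)) (a : Fin n → K)
    (i : Fin n) : dotWeight w a i + rho i = a (w⁻¹ i) + rho (w⁻¹ i) := by
  simp [dotWeight]

theorem evalUh_theta_dotWeight (w : Equiv.Perm (Fin n)) (a : Fin n → ZMod p) :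
    evalUh F (dotWeight w a) (theta n F p) = evalUh F a (theta n F p) := by
  rw [evalUh_theta, evalUh_theta, pt_dotWeight]
  simp only [dotWeight_add_rho]
  refine Finset.prod_equiv (Equiv.prodCongr w⁻¹ w⁻¹) ?_ ?_
  · rintro ⟨i, j⟩; simp
  · rintro ⟨i, j⟩ _; rfl

theorem evalUh_theta_eq_zero {a : Fin n → ZMod p} (h : evalUh F a (theta n F p) = 0) :
    ∃ i j, i ≠ j ∧ a i + rho i = a j + rho j + 1 := by
  rw [evalUh_theta, Finset.prod_eq_zero_iff] at h
  obtain ⟨⟨i, j⟩, hij, h⟩ := h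
  refine ⟨i, j, by simpa using hij, (ZMod.castHom (dvd_refl p) F).injective ?_⟩
  rw [sub_sub, sub_eq_zero] at h
  simpa [pt, rho] using h

/-- With c the common value of f at the zeros of Θ, divide f - c by Θ pointwise. The convention x /
0 = 0 gives the quotient at those zeros, where its value is immaterial, and keeps it invariant. -/
theorem exists_eq_theta_mul_add {f : uh n F p}
    (hW : ∀ w a, evalUh F (dotWeight w a) f = evalUh F a f)
    (hΘ : ∀ a b, evalUh F a (theta n F p) = 0 → evalUh F b (theta n F p) = 0 →
      evalUh F a f = evalUh F b f) :
    ∃ q ∈ uhInv n F p, ∃ c : F, f = theta n F p * q + algebraMap F (uh n F p) c := by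
  obtain ⟨c, hc⟩ : ∃ c, ∀ a, evalUh F a (theta n F p) = 0 → evalUh F a f = c := by
    by_cases h : ∃ a, evalUh F a (theta n F p) = 0
    · obtain ⟨a, ha⟩ := h
      exact ⟨evalUh F a f, fun b hb => hΘ b a hb ha⟩
    · exact ⟨0, fun a ha => absurd ⟨a, ha⟩ h⟩
  obtain ⟨q, hq⟩ := exists_evalUh_eq (F := F)
    (fun a : Fin n → ZMod p => (evalUh F a f - c) / evalUh F a (theta n F p))
  refine ⟨q, mem_uhInv fun w a => ?_, c, ?_⟩
  · rw [hq, hq, hW, evalUh_theta_dotWeight]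
  · rw [← sub_eq_zero]
    refine uh_ext fun a => ?_
    rw [map_sub, map_add, map_mul, hq, AlgHom.commutes]
    by_cases h : evalUh F a (theta n F p) = 0
    · rw [h, hc a h]; simp
    · rw [mul_div_cancel₀ _ h]; simp

end Functions

/-! ### Highest weight vectors and the eigenvalues of elements of ū on them. -/

section Singular

variable {n : ℕ} {F : Type*} [Field F] {p : ℕ} [Fact p.Prime] [CharP F p]
  {M : Type*} [AddCommGroup M] [Module F M]

/-- `v` is a highest weight vector of weight `a ∈ F_p^n` in a `u(𝔤)`-module. -/
structure IsSingular (Φ : u n F p →ₐ[F] Module.End F M) (a : Fin n → ZMod p) (v : M) : Prop where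
  ne_zero : v ≠ 0
  upper : ∀ A : Matrix (Fin n) (Fin n) F, (∀ i j, j ≤ i → A i j = 0) →
    Φ (ιu n F p (aElt A)) v = 0
  degOne : ∀ B hB, Φ (ιu n F p (bElt B hB)) v = 0
  diag : ∀ d : Fin n → F, Φ (ιu n F p (aElt (Matrix.diagonal d))) v = (∑ i, d i * pt F a i) • v

theorem hElt_eq_aElt (i : Fin n) : hElt F i = aElt (Matrix.diagonal (Pi.single i 1)) := by
  ext1
  simp [hElt, aElt]

variable {Φ : u n F p →ₐ[F] Module.End F M} {a : Fin n → ZMod p} {v : M}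

theorem IsSingular.hElt (h : IsSingular Φ a v) (i : Fin n) :
    Φ (ιu n F p (hElt F i)) v = pt F a i • v := by
  rw [hElt_eq_aElt, h.diag]
  simp [Pi.single_apply]

theorem IsSingular.mem_layer (h : IsSingular Φ a v) : v ∈ layer Φ 0 := by
  rw [mem_layer_zero]
  intro b hb
  obtain ⟨B, hB, rfl⟩ := exists_eq_bElt hb
  exact h.degOne B hB

theorem exists_eq_of_mem_nPlus {x : pn n F} (hx : x ∈ nPlus n F) :
    ∃ A B hB, (∀ i j, j ≤ i → A i j = 0) ∧ x = aElt A + bElt B hB := by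
  obtain ⟨A, B, hB, C, hC, rfl⟩ := exists_decomp x
  have hC0 : C = 0 := by
    have := hx.1
    simp [aElt, bElt, cElt, Matrix.fromBlocks_add] at this
    exact this
  subst hC0
  refine ⟨A, B, hB, fun i j hij => ?_, ?_⟩
  · have := hx.2 i j hij
    simpa [aElt, bElt, cElt] using this
  · ext1
    simp [aElt, bElt, cElt, Matrix.fromBlocks_add]

theorem IsSingular.nPlus (h : IsSingular Φ a v) {x : pn n F} (hx : x ∈ nPlus n F) :
    Φ (ιu n F p x) v = 0 := by
  obtain ⟨A, B, hB, hA, rfl⟩ := exists_eq_of_mem_nPlus hx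
  rw [map_add, map_add, LinearMap.add_apply, h.upper A hA, h.degOne B hB, add_zero]

theorem nilAction_polyToUbar (h : IsSingular Φ a v) (hv : v ∈ nilPart Φ)
    (f : MvPolynomial (Fin n) F) :
    nilAction Φ (polyToUbar n F p f) ⟨v, hv⟩ = MvPolynomial.eval (pt F a) f • ⟨v, hv⟩ := by
  induction f using MvPolynomial.induction_on with
  | C c =>
    rw [show (MvPolynomial.C c : MvPolynomial (Fin n) F) = algebraMap F _ c from rfl,
      AlgHom.commutes, AlgHom.commutes, Module.algebraMap_end_apply]
    simp
  | add f g hf hg => rw [map_add, map_add, map_add, LinearMap.add_apply, hf, hg, add_smul]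
  | mul_X f i hf =>
    have hi : nilAction Φ (ι n F p (hElt F i)) ⟨v, hv⟩ = pt F a i • ⟨v, hv⟩ := by
      refine Subtype.ext ?_
      rw [nilAction_ι]
      exact h.hElt i
    rw [map_mul, map_mul, map_mul, Module.End.mul_apply, polyToUbar_X, hi, map_smul, hf,
      MvPolynomial.eval_X, smul_smul, mul_comm]

/-- A representative of `z` modulo `ū 𝔫⁺` acts on highest weight vectors as `z`. -/
theorem nilAction_singular (h : IsSingular Φ a v) (hv : v ∈ nilPart Φ) {z : ubar n F p}
    {f : uh n F p} (hz : z - uhToUbar n F p f ∈ lIdeal n F p) :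
    nilAction Φ z ⟨v, hv⟩ = evalUh F a f • ⟨v, hv⟩ := by
  have h1 : ∀ y ∈ Ideal.span (ι n F p '' (nPlus n F : Set (pn n F))),
      nilAction Φ y ⟨v, hv⟩ = 0 := by
    intro y hy
    refine Submodule.span_induction (p := fun y _ => nilAction Φ y ⟨v, hv⟩ = 0) ?_ (by simp)
      (fun x y _ _ hx hy => by rw [map_add, LinearMap.add_apply, hx, hy, add_zero])
      (fun r x _ hx => by rw [smul_eq_mul, map_mul, Module.End.mul_apply, hx, map_zero]) hy
    rintro _ ⟨x, hx, rfl⟩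
    refine Subtype.ext ?_
    rw [nilAction_ι]
    exact h.nPlus hx
  have h2 := h1 _ hz.1
  rw [map_sub, LinearMap.sub_apply, sub_eq_zero] at h2
  rw [h2]
  obtain ⟨f, rfl⟩ := Ideal.Quotient.mk_surjective f
  rw [evalUh_mk]
  exact nilAction_polyToUbar h hv f

end Singular

/-! ### Products of fermions in Fock space. -/

namespace Oscillator

variable {n : ℕ} {S : Type*} {F : Type*} [Field F] [DecidableEq S] {M : Type*}
  [AddCommGroup M] [Module F M] (O : Oscillator n S F M)

/-- `v` is annihilated by the creation operators of the set `D` of fermions and by all other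
annihilation operators. -/
structure IsOcc (D : Finset (Fin n × S)) (v : M) : Prop where
  ne_zero : v ≠ 0
  cr : ∀ i s, (i, s) ∈ D → O.cr (.inl i) s v = 0
  an : ∀ i s, (i, s) ∉ D → O.an (.inl i) s v = 0
  an_inr : ∀ i s, O.an (.inr i) s v = 0

variable {O}

/-- Creating a fermion in an empty state gives a nonzero vector because annihilating it returns v.
-/
theorem IsOcc.insert {D : Finset (Fin n × S)} {v : M} (h : O.IsOcc D v) {i : Fin n} {s : S}
    (hi : (i, s) ∉ D) : O.IsOcc (insert (i, s) D) (O.cr (.inl i) s v) where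
  ne_zero h0 := by
    have := O.an_cr (.inl i) (.inl i) s s v
    rw [h0, h.an i s hi] at this
    simp at this
    exact h.ne_zero this.symm
  cr j t hj := by
    rw [Finset.mem_insert] at hj
    rcases hj with hj | hj
    · obtain ⟨rfl, rfl⟩ := Prod.mk.inj hj
      exact O.cr_inl_sq _ _ _
    · rw [O.cr_cr, h.cr j t hj, map_zero, smul_zero]
  an j t hj := by
    rw [Finset.mem_insert, not_or] at hj
    rw [O.an_cr, h.an j t hj.2, map_zero, smul_zero, zero_add, if_neg]
    rintro ⟨h1, rfl⟩
    cases h1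
    exact hj.1 rfl
  an_inr j t := by
    rw [O.an_cr, h.an_inr, map_zero, smul_zero, zero_add, if_neg]
    simp

variable (O) in
theorem exists_isOcc (D : Finset (Fin n × S)) : ∃ v, O.IsOcc D v := by
  induction D using Finset.induction_on with
  | empty =>
    exact ⟨O.vac, O.vac_ne_zero, by simp, fun _ _ _ => O.an_vac _ _, fun _ _ => O.an_vac _ _⟩
  | insert d D hd ih =>
    obtain ⟨v, hv⟩ := ih
    exact ⟨_, hv.insert hd⟩

variable [Fintype S] {D : Finset (Fin n × S)} {v : M}

/-- Exclusion principle: if A moves filled states only to filled states, the off-diagonal terms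
vanish, and the diagonal ones count the fermions in each row. -/
theorem IsOcc.op_aElt (h : O.IsOcc D v) {A : Matrix (Fin n) (Fin n) F}
    (hA : ∀ i j s, A j i ≠ 0 → (i, s) ∈ D → (j, s) ∈ D) :
    O.op (aElt A) v =
      (∑ i, A i i * ((Finset.univ.filter fun s => (i, s) ∈ D).card : F)) • v := by
  have key : ∀ s i j, A j i • O.cr (.inl j) s (O.an (.inl i) s v) =
      if i = j then if (i, s) ∈ D then A i i • v else 0 else 0 := by
    intro s i j
    by_cases hD : (i, s) ∈ D
    · have h1 := O.an_cr (.inl i) (.inl j) s s v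
      by_cases hj : A j i = 0
      · rw [hj, zero_smul]
        split_ifs with hij
        · subst hij; rw [hj, zero_smul]
        · rfl
      rw [h.cr j s (hA i j s hj hD), map_zero] at h1
      have h2 : O.cr (.inl j) s (O.an (.inl i) s v) = if i = j then v else 0 := by
        simp only [sg, neg_smul, one_smul, Sum.inl.injEq, and_true] at h1
        exact (neg_add_eq_zero.1 h1.symm)
      rw [h2]
      by_cases hij : i = j
      · subst hij; simp [hD]
      · simp [hij]
    · rw [h.an i s hD, map_zero, smul_zero]
      simp [hD]
  rw [op_apply]
  simp only [Fintype.sum_sum_type, h.an_inr, map_zero, smul_zero, Finset.sum_const_zero, add_zero]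
  simp only [aElt, Matrix.fromBlocks_apply₁₁, Matrix.fromBlocks_apply₂₁, Matrix.zero_apply,
    zero_smul, Finset.sum_const_zero, add_zero, key, Finset.sum_ite_eq, Finset.mem_univ, if_true]
  rw [Finset.sum_comm, Finset.sum_smul]
  refine Finset.sum_congr rfl fun i _ => ?_
  rw [← Finset.sum_filter, Finset.sum_const, mul_comm, mul_smul, Nat.cast_smul_eq_nsmul]

/-- 𝔤_1 turns bosons into fermions, and v contains no bosons. -/
theorem IsOcc.op_bElt (h : O.IsOcc D v) (B : Matrix (Fin n) (Fin n) F) (hB : B.transpose = B) :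
    O.op (bElt B hB) v = 0 := by
  rw [op_apply]
  simp only [Fintype.sum_sum_type, h.an_inr, map_zero, smul_zero, Finset.sum_const_zero, add_zero]
  simp [bElt]

/-- As `cr (inl j) s` kills v, vanishing of c v would make the bracket of c with this operator kill
v. The bracket is a sum of bosonic creation operators with coefficients from column j of C;
annihilating the boson (i, s) leaves C i j • v. -/
theorem IsOcc.op_cElt_ne_zero (h : O.IsOcc D v) {C : Matrix (Fin n) (Fin n) F}
    (hC : C.transpose = -C) {i j : Fin n} {s : S} (hj : (j, s) ∈ D) (hij : C i j ≠ 0) :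
    O.op (cElt C hC) v ≠ 0 := by
  intro h0
  have h1 := O.op_cr (isPar_odd (cElt_mem C hC).1) (.inl j) s v
  rw [h.cr j s hj, h0, map_zero, map_zero, smul_zero, zero_add, Fintype.sum_sum_type] at h1
  simp only [cElt, Matrix.fromBlocks_apply₁₁, Matrix.fromBlocks_apply₂₁, Matrix.zero_apply,
    zero_smul, Finset.sum_const_zero, zero_add] at h1
  have h2 := congrArg (O.an (.inr i) s) h1
  simp only [map_zero, map_sum, map_smul, O.an_cr, h.an_inr, smul_zero, zero_add, Sum.inr.injEq,
    and_true, smul_ite, Finset.sum_ite_eq, Finset.mem_univ, if_true] at h2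
  exact h.ne_zero ((smul_eq_zero.1 h2.symm).resolve_left hij)

theorem cr_lowering {i j : Fin n} (hij : i ≠ j) (s : S) (m : M) (k : ℕ) :
    O.cr (.inl j) s ((O.op (aElt (Matrix.single j i (1 : F))) ^ k) m) =
      (O.op (aElt (Matrix.single j i (1 : F))) ^ k) (O.cr (.inl j) s m) := by
  induction k with
  | zero => rfl
  | succ k ih =>
    have h1 := O.op_cr (isPar_even (aElt_even (Matrix.single j i (1 : F)))) (.inl j) s
      ((O.op (aElt (Matrix.single j i (1 : F))) ^ k) m)
    rw [pow_succ', Module.End.mul_apply, Module.End.mul_apply, ← ih, h1, Fintype.sum_sum_type]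
    simp [aElt, hij]

/-- Bracketing e_{ji} with the i-th creation operator gives the j-th one, which commutes with
e_{ji}; hence the factor k + 1. -/
theorem cr_lowering_pow {i j : Fin n} (hij : i ≠ j) (s : S) (hv : O.cr (.inl i) s v = 0) (k : ℕ) :
    O.cr (.inl i) s ((O.op (aElt (Matrix.single j i (1 : F))) ^ (k + 1)) v) =
      -((k + 1 : F) • (O.op (aElt (Matrix.single j i (1 : F))) ^ k) (O.cr (.inl j) s v)) := by
  have h1 : ∀ m, O.cr (.inl i) s (O.op (aElt (Matrix.single j i (1 : F))) m) =
      O.op (aElt (Matrix.single j i (1 : F))) (O.cr (.inl i) s m) - O.cr (.inl j) s m := by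
    intro m
    rw [O.op_cr (isPar_even (aElt_even (Matrix.single j i (1 : F)))), Fintype.sum_sum_type]
    simp [aElt, Matrix.single_apply]
  induction k with
  | zero => simp [h1, hv]
  | succ k ih =>
    rw [pow_succ', Module.End.mul_apply, h1, ih, cr_lowering hij, map_neg, map_smul,
      ← Module.End.mul_apply, ← pow_succ', ← neg_add', Nat.cast_succ,
      add_smul ((k : F) + 1) 1, one_smul]

/-- T lists copies in which i is filled and j is empty. Applying the i-th creation operator of a
copy s in T trades one factor e_{ji} for a new fermion at (j, s), with a scalar that is nonzero
since k < p; s then leaves T. -/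
theorem IsOcc.lowering_pow_ne_zero {p : ℕ} [Fact p.Prime] [CharP F p] {i j : Fin n} (hij : i ≠ j)
    {k : ℕ} (hk : k < p) {D : Finset (Fin n × S)} {v : M} (h : O.IsOcc D v) (T : Finset S)
    (hT : ∀ s ∈ T, (i, s) ∈ D ∧ (j, s) ∉ D) (hkT : k ≤ T.card) :
    (O.op (aElt (Matrix.single j i (1 : F))) ^ k) v ≠ 0 := by
  induction k generalizing D v T with
  | zero => simpa using h.ne_zero
  | succ k ih =>
    intro h0
    obtain ⟨s, hs⟩ : T.Nonempty := Finset.card_pos.1 (by omega)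
    have h1 := cr_lowering_pow hij s (h.cr i s (hT s hs).1) k
    rw [h0, map_zero, eq_comm, neg_eq_zero, smul_eq_zero] at h1
    rcases h1 with h1 | h1
    · have h2 : ((k + 1 : ℕ) : F) = 0 := by exact_mod_cast h1
      rw [CharP.cast_eq_zero_iff F p] at h2
      exact absurd (Nat.le_of_dvd (by omega) h2) (by omega)
    · refine ih (by omega) (h.insert (hT s hs).2) (T.erase s) ?_ ?_ h1
      · intro t ht
        rw [Finset.mem_erase] at ht
        refine ⟨Finset.mem_insert_of_mem (hT t ht.2).1, ?_⟩
        rw [Finset.mem_insert, not_or]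
        exact ⟨fun h => ht.1 (Prod.mk.inj h).2, (hT t ht.2).2⟩
      · rw [Finset.card_erase_of_mem hs]
        omega

end Oscillator

/-! ### New highest weight vectors from old ones. -/

section Singular

variable {n : ℕ} {F : Type*} [Field F] {p : ℕ} [Fact p.Prime] [CharP F p]
  {M : Type*} [AddCommGroup M] [Module F M]

theorem aElt_add (A A' : Matrix (Fin n) (Fin n) F) : aElt (A + A') = aElt A + aElt A' := by
  ext1
  simp [aElt, Matrix.fromBlocks_add, add_comm]

theorem aElt_smul (c : F) (A : Matrix (Fin n) (Fin n) F) : aElt (c • A) = c • aElt A := by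
  ext1
  simp [aElt, Matrix.fromBlocks_smul]

theorem mul_single_one_apply (A : Matrix (Fin n) (Fin n) F) (i j r c : Fin n) :
    (A * Matrix.single j i (1 : F)) r c = if i = c then A r j else 0 := by
  simp [Matrix.mul_apply, Matrix.single_apply, ite_and]

theorem single_one_mul_apply (A : Matrix (Fin n) (Fin n) F) (i j r c : Fin n) :
    (Matrix.single j i (1 : F) * A) r c = if j = r then A i c else 0 := by
  simp [Matrix.mul_apply, Matrix.single_apply, ite_and]

variable {Φ : u n F p →ₐ[F] Module.End F M} {a : Fin n → ZMod p} {v : M}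

theorem action_aa (Φ : u n F p →ₐ[F] Module.End F M) (A A' : Matrix (Fin n) (Fin n) F) (m : M) :
    Φ (ιu n F p (aElt A)) (Φ (ιu n F p (aElt A')) m) =
      Φ (ιu n F p (aElt A')) (Φ (ιu n F p (aElt A)) m) +
        Φ (ιu n F p (aElt (A * A' - A' * A))) m :=
  congrArg (fun f : Module.End F M => f m) (bracket_aa Φ A A')

theorem action_ab (Φ : u n F p →ₐ[F] Module.End F M) (A B : Matrix (Fin n) (Fin n) F)
    (hB : B.transpose = B) (m : M) :
    Φ (ιu n F p (aElt A)) (Φ (ιu n F p (bElt B hB)) m) =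
      Φ (ιu n F p (bElt B hB)) (Φ (ιu n F p (aElt A)) m) +
        Φ (ιu n F p (bElt (A * B + B * A.transpose) (bracket_ab_symm A hB))) m :=
  congrArg (fun f : Module.End F M => f m) (bracket_ab Φ A B hB)

theorem action_ac (Φ : u n F p →ₐ[F] Module.End F M) (A C : Matrix (Fin n) (Fin n) F)
    (hC : C.transpose = -C) (m : M) :
    Φ (ιu n F p (aElt A)) (Φ (ιu n F p (cElt C hC)) m) =
      Φ (ιu n F p (cElt C hC)) (Φ (ιu n F p (aElt A)) m) +
        Φ (ιu n F p (cElt (-(A.transpose * C) - C * A) (bracket_ac_skew A hC))) m :=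
  congrArg (fun f : Module.End F M => f m) (bracket_ac Φ A C hC)

theorem action_bc (Φ : u n F p →ₐ[F] Module.End F M) (B : Matrix (Fin n) (Fin n) F)
    (hB : B.transpose = B) (C : Matrix (Fin n) (Fin n) F) (hC : C.transpose = -C) (m : M) :
    Φ (ιu n F p (bElt B hB)) (Φ (ιu n F p (cElt C hC)) m) =
      -(Φ (ιu n F p (cElt C hC)) (Φ (ιu n F p (bElt B hB)) m)) +
        Φ (ιu n F p (aElt (B * C))) m :=
  congrArg (fun f : Module.End F M => f m) (bracket_bc Φ B hB C hC)

theorem IsSingular.degOne_lowering_pow (h : IsSingular Φ a v) (A : Matrix (Fin n) (Fin n) F)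
    (k : ℕ) (B) (hB) : Φ (ιu n F p (bElt B hB)) ((Φ (ιu n F p (aElt A)) ^ k) v) = 0 := by
  induction k generalizing B with
  | zero => exact h.degOne B hB
  | succ k ih =>
    have h1 := action_ab Φ A B hB ((Φ (ιu n F p (aElt A)) ^ k) v)
    rw [ih, ih, map_zero, add_zero] at h1
    rw [pow_succ', Module.End.mul_apply]
    exact h1.symm

theorem IsSingular.diag_lowering_pow (h : IsSingular Φ a v) (i j : Fin n) (d : Fin n → F) (k : ℕ) :
    Φ (ιu n F p (aElt (Matrix.diagonal d)))
        ((Φ (ιu n F p (aElt (Matrix.single j i (1 : F)))) ^ k) v) =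
      (∑ m, d m * pt F a m + k * (d j - d i)) •
        (Φ (ιu n F p (aElt (Matrix.single j i (1 : F)))) ^ k) v := by
  induction k with
  | zero => simpa using h.diag d
  | succ k ih =>
    have hbr : Matrix.diagonal d * Matrix.single j i (1 : F) -
        Matrix.single j i (1 : F) * Matrix.diagonal d =
          (d j - d i) • Matrix.single j i (1 : F) := by
      ext r c
      simp only [Matrix.sub_apply, Matrix.diagonal_mul, Matrix.mul_diagonal, Matrix.smul_apply,
        smul_eq_mul, Matrix.single_apply]
      split_ifs with h
      · rw [h.1, h.2]; ring
      · ring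
    rw [pow_succ', Module.End.mul_apply, action_aa, ih, hbr, aElt_smul]
    simp only [map_smul, LinearMap.smul_apply]
    rw [← add_smul]
    congr 1
    push_cast
    ring

/-- The 𝔰𝔩₂ identity e f^k v = k (λ - k + 1) f^(k-1) v for the simple root ε_i - ε_j. The rest of A
contributes nothing, since its bracket with e_{ji} is again strictly upper triangular with zero
entry at (i, j). At k = 0 the truncated exponent is harmless, the coefficient being 0. -/
theorem IsSingular.upper_lowering_pow (h : IsSingular Φ a v) {i j : Fin n}
    (hij : (j : ℕ) = i + 1) (k : ℕ) {A : Matrix (Fin n) (Fin n) F}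
    (hA : ∀ i j, j ≤ i → A i j = 0) :
    Φ (ιu n F p (aElt A)) ((Φ (ιu n F p (aElt (Matrix.single j i (1 : F)))) ^ k) v) =
      (A i j * (k * (pt F a i - pt F a j - k + 1))) •
        (Φ (ιu n F p (aElt (Matrix.single j i (1 : F)))) ^ (k - 1)) v := by
  have hne : i ≠ j := by rintro rfl; omega
  induction k generalizing A with
  | zero => simpa using h.upper A hA
  | succ k ih =>
    obtain ⟨A', hA', hA'0, hbr⟩ : ∃ A' : Matrix (Fin n) (Fin n) F,
        (∀ i j, j ≤ i → A' i j = 0) ∧ A' i j = 0 ∧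
        A * Matrix.single j i (1 : F) - Matrix.single j i (1 : F) * A =
          A' + Matrix.diagonal (Pi.single i (A i j) - Pi.single j (A i j)) := by
      refine ⟨_, ?_, ?_, (sub_add_cancel _ _).symm⟩
      · intro r c hrc
        have hrc' : (c : ℕ) ≤ r := hrc
        have h1 : i = c → r ≠ c → A r j = 0 := fun h1 h2 => hA _ _ (by
          subst h1; have := Fin.val_ne_of_ne h2; show (j : ℕ) ≤ r; omega)
        have h2 : j = r → r ≠ c → A i c = 0 := fun h1 h2 => hA _ _ (by
          subst h1; have := Fin.val_ne_of_ne h2; show (c : ℕ) ≤ i; omega)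
        simp only [Matrix.sub_apply, mul_single_one_apply, single_one_mul_apply,
          Matrix.diagonal_apply, Pi.sub_apply, Pi.single_apply]
        by_cases hrc2 : r = c
        · subst hrc2
          by_cases hi : i = r
          · subst hi; simp [hne.symm, hne]
          · by_cases hj : j = r
            · subst hj; simp [hne, hne.symm]
            · simp [hi, hj, Ne.symm hi, Ne.symm hj]
        · by_cases hi : i = c <;> by_cases hj : j = r <;>
            simp [hrc2, hi, hj, h1, h2]
          rw [hA r r le_rfl, hA c c le_rfl, sub_self]
      · simp only [Matrix.sub_apply, mul_single_one_apply, single_one_mul_apply,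
          Matrix.diagonal_apply]
        simp [hne, hne.symm]
    rw [pow_succ', Module.End.mul_apply, action_aa, ih hA, hbr, aElt_add]
    simp only [map_add, LinearMap.add_apply, map_smul]
    rw [ih hA', hA'0, h.diag_lowering_pow, zero_mul, zero_smul, zero_add]
    have hd : ∑ m, (Pi.single i (A i j) - Pi.single j (A i j) : Fin n → F) m * pt F a m =
        A i j * (pt F a i - pt F a j) := by
      simp [sub_mul, Finset.sum_sub_distrib, Pi.single_apply, mul_sub]
    rw [hd]
    simp only [Pi.sub_apply, Pi.single_eq_same, Pi.single_eq_of_ne hne, Pi.single_eq_of_ne hne.symm,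
      Nat.add_sub_cancel]
    rcases Nat.eq_zero_or_pos k with rfl | hk
    · simp
    · have : Φ (ιu n F p (aElt (Matrix.single j i (1 : F))))
          ((Φ (ιu n F p (aElt (Matrix.single j i (1 : F)))) ^ (k - 1)) v) =
          (Φ (ιu n F p (aElt (Matrix.single j i (1 : F)))) ^ k) v := by
        rw [← Module.End.mul_apply, ← pow_succ', Nat.sub_add_cancel hk]
      rw [this, ← add_smul]
      congr 1
      push_cast
      ring

/-- This k makes the 𝔰𝔩₂ coefficient vanish, and a - k (ε_i - ε_j) is the image of a under the
simple reflection for the dot action. -/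
theorem IsSingular.lowering_pow (h : IsSingular Φ a v) {i j : Fin n} (hij : (j : ℕ) = i + 1)
    {k : ℕ} (hk : (k : ZMod p) = a i - a j + 1)
    (hne : (Φ (ιu n F p (aElt (Matrix.single j i (1 : F)))) ^ k) v ≠ 0) :
    IsSingular Φ (dotWeight (Equiv.swap i j) a)
      ((Φ (ιu n F p (aElt (Matrix.single j i (1 : F)))) ^ k) v) where
  ne_zero := hne
  upper A hA := by
    rw [h.upper_lowering_pow hij k hA]
    have hk' := congrArg (ZMod.castHom (dvd_refl p) F) hk
    rw [map_natCast, map_add, map_sub, map_one] at hk'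
    rw [hk', pt, pt]
    ring_nf
    simp
  degOne := h.degOne_lowering_pow _ k
  diag d := by
    have hne' : i ≠ j := by rintro rfl; omega
    rw [h.diag_lowering_pow]
    congr 1
    have h1 : ∀ m, dotWeight (Equiv.swap i j) a m =
        a m + (if m = j then (k : ZMod p) else 0) - (if m = i then (k : ZMod p) else 0) := by
      intro m
      by_cases hm : m = j
      · subst hm
        simp [dotWeight, hk, rho, hij, hne'.symm]
        ring
      · by_cases hm' : m = i
        · subst hm'
          simp [dotWeight, hk, rho, hij, hne']
          ring
        · simp [dotWeight, Equiv.swap_apply_of_ne_of_ne hm' hm, hm, hm']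
    have h2 : ∀ m, pt F (dotWeight (Equiv.swap i j) a) m =
        pt F a m + (if m = j then (k : F) else 0) - (if m = i then (k : F) else 0) := by
      intro m
      rw [pt, h1]
      simp only [map_add, map_sub, apply_ite (ZMod.castHom (dvd_refl p) F), map_natCast, map_zero]
      rfl
    simp only [h2, mul_sub, mul_add, Finset.sum_sub_distrib, Finset.sum_add_distrib, mul_ite,
      mul_zero, Finset.sum_ite_eq', Finset.mem_univ, if_true]
    ring

/-- The skew-symmetric matrix `e_{ij} - e_{ji}`. -/
def skewSingle (i j : Fin n) : Matrix (Fin n) (Fin n) F :=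
  Matrix.single i j 1 - Matrix.single j i 1

theorem skewSingle_transpose (i j : Fin n) :
    (skewSingle i j : Matrix (Fin n) (Fin n) F).transpose = -skewSingle i j := by
  simp [skewSingle]

theorem mul_skewSingle_apply (A : Matrix (Fin n) (Fin n) F) (i j r c : Fin n) :
    (A * skewSingle i j : Matrix (Fin n) (Fin n) F) r c =
      (if j = c then A r i else 0) - (if i = c then A r j else 0) := by
  rw [skewSingle, mul_sub, Matrix.sub_apply, mul_single_one_apply, mul_single_one_apply]

theorem skewSingle_mul_apply (A : Matrix (Fin n) (Fin n) F) (i j r c : Fin n) :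
    (skewSingle i j * A : Matrix (Fin n) (Fin n) F) r c =
      (if i = r then A j c else 0) - (if j = r then A i c else 0) := by
  rw [skewSingle, sub_mul, Matrix.sub_apply, single_one_mul_apply, single_one_mul_apply]

theorem cElt_zero : cElt (0 : Matrix (Fin n) (Fin n) F) (by simp) = 0 := by
  ext1
  simp [cElt]

theorem cElt_smul (x : F) (C : Matrix (Fin n) (Fin n) F) (hC : C.transpose = -C)
    (hC' : (x • C).transpose = -(x • C)) : cElt (x • C) hC' = x • cElt C hC := by
  ext1
  simp [cElt, Matrix.fromBlocks_smul]

theorem cElt_congr {C C' : Matrix (Fin n) (Fin n) F} (h : C = C') {hC : C.transpose = -C} :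
    cElt C hC = cElt C' (h ▸ hC) := by
  subst h; rfl

/-- For the last two indices, c is the highest weight vector of 𝔤_{-1}, so it commutes with the
strictly upper triangular part of 𝔤_0̄. For b in 𝔤_1, [b, c] is the sum of a strictly upper
triangular matrix, a multiple of h_j - h_i and a multiple of e_{ji}; the last two kill v by `haij`
and `hlow`. -/
theorem IsSingular.cElt_skewSingle (h : IsSingular Φ a v) {i j : Fin n} (hi : (i : ℕ) + 2 = n)
    (hj : (j : ℕ) + 1 = n) (haij : a i = a j)
    (hlow : Φ (ιu n F p (aElt (Matrix.single j i (1 : F)))) v = 0)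
    (hne : Φ (ιu n F p (cElt (skewSingle i j) (skewSingle_transpose i j))) v ≠ 0) :
    IsSingular Φ (a - Pi.single i 1 - Pi.single j 1)
      (Φ (ιu n F p (cElt (skewSingle i j) (skewSingle_transpose i j))) v) where
  ne_zero := hne
  upper A hA := by
    have hij : i ≠ j := by rintro rfl; omega
    rw [action_ac, h.upper A hA, map_zero, zero_add]
    have h0 : -(A.transpose * skewSingle i j) - skewSingle i j * A =
        (0 : Matrix (Fin n) (Fin n) F) := by
      ext r c
      have h1 : ∀ y, A j y = 0 := fun y => hA _ _ (by show (y : ℕ) ≤ j; omega)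
      have h2 : ∀ y, y ≠ j → A i y = 0 := fun y hy => hA _ _ (by
        have := Fin.val_ne_of_ne hy; show (y : ℕ) ≤ i; omega)
      rw [Matrix.sub_apply, Matrix.neg_apply, mul_skewSingle_apply, skewSingle_mul_apply]
      simp only [Matrix.transpose_apply, h1, Matrix.zero_apply]
      by_cases hr : r = j
      · by_cases hc : c = j
        · simp [hr, hc, hij]
        · simp [hr, hc, Ne.symm hc, h2]
      · simp [h2 r hr, Ne.symm hr]
    rw [cElt_congr h0, cElt_zero, map_zero, map_zero, LinearMap.zero_apply]
  degOne B hB := by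
    have hij : i ≠ j := by rintro rfl; omega
    rw [action_bc, h.degOne B hB, map_zero, neg_zero, zero_add]
    obtain ⟨U, hU, hdec⟩ : ∃ U : Matrix (Fin n) (Fin n) F, (∀ i j, j ≤ i → U i j = 0) ∧
        B * skewSingle i j = U + (Matrix.diagonal (Pi.single j (B j i) - Pi.single i (B i j)) +
          (-B j j) • Matrix.single j i 1) := by
      refine ⟨_, ?_, (sub_add_cancel _ _).symm⟩
      intro r c hrc
      have hrc' : (c : ℕ) ≤ r := hrc
      have hr := r.2
      rw [Matrix.sub_apply, mul_skewSingle_apply, Matrix.add_apply, Matrix.smul_apply,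
        Matrix.diagonal_apply, Matrix.single_apply, Pi.sub_apply, Pi.single_apply, Pi.single_apply]
      by_cases hcj : c = j
      · have hrj : r = j := by subst hcj; ext; omega
        subst hrj hcj
        simp [hij, hij.symm]
      by_cases hci : c = i
      · subst hci
        by_cases hrc2 : r = c
        · subst hrc2
          simp [hij, hij.symm]
        · have hrj : r = j := by have := Fin.val_ne_of_ne hrc2; ext; omega
          subst hrj
          simp [hij.symm]
      · by_cases hrc2 : r = c
        · subst hrc2; simp [hcj, hci, Ne.symm hcj, Ne.symm hci]
        · simp [hrc2, Ne.symm hcj, Ne.symm hci]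
    have hs : B j i = B i j := congrFun₂ hB i j
    rw [hdec, aElt_add, aElt_add, aElt_smul]
    simp only [map_add, map_smul, LinearMap.add_apply, LinearMap.smul_apply]
    rw [h.upper U hU, hlow, h.diag]
    simp [sub_mul, Finset.sum_sub_distrib, Pi.single_apply, pt, haij, hs]
  diag d := by
    rw [action_ac, h.diag, map_smul]
    have h0 : -((Matrix.diagonal d).transpose * skewSingle i j) - skewSingle i j * Matrix.diagonal d
        = (-(d i + d j)) • skewSingle i j := by
      ext r c
      rw [Matrix.sub_apply, Matrix.neg_apply, Matrix.smul_apply, Matrix.diagonal_transpose,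
        Matrix.diagonal_mul, Matrix.mul_diagonal, smul_eq_mul]
      by_cases h1 : i = r ∧ j = c
      · rw [h1.1, h1.2]; ring
      by_cases h2 : j = r ∧ i = c
      · rw [h2.1, h2.2]; ring
      rw [skewSingle, Matrix.sub_apply, Matrix.single_apply, Matrix.single_apply, if_neg h1,
        if_neg h2]
      ring
    rw [cElt_congr h0, cElt_smul _ _ (skewSingle_transpose i j)]
    simp only [map_smul, LinearMap.smul_apply]
    rw [← add_smul]
    congr 1
    have h1 : ∀ m, pt F (a - Pi.single i 1 - Pi.single j 1) m =
        pt F a m - (if m = i then 1 else 0) - (if m = j then 1 else 0) := by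
      intro m
      simp only [pt, Pi.sub_apply, Pi.single_apply, map_sub,
        apply_ite (ZMod.castHom (dvd_refl p) F), map_one, map_zero]
    simp only [h1, mul_sub, Finset.sum_sub_distrib, mul_ite, mul_one, mul_zero,
      Finset.sum_ite_eq', Finset.mem_univ, if_true]
    ring

end Singular

/-! ### Existence of highest weight vectors of every weight in F_p^n. -/

section Highest

variable {n : ℕ} {F : Type*} [Field F] {p : ℕ} [Fact p.Prime] [CharP F p]

theorem exists_sum_Ici_eq {G : Type*} [AddCommGroup G] (a : Fin n → G) :
    ∃ d : Fin n → G, ∀ i, ∑ j ∈ Finset.Ici i, d j = a i := by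
  -- Extending a by 0 at n makes d_j = a_j - a_{j+1} telescope to a_i also at the end.
  let a' : ℕ → G := fun k => if h : k < n then a ⟨k, h⟩ else 0
  refine ⟨fun j => a' j - a' (j + 1), fun i => ?_⟩
  have h1 : ∑ j ∈ Finset.Ici i, (a' j - a' (j + 1)) =
      ∑ k ∈ Finset.Ico (i : ℕ) n, (a' k - a' (k + 1)) := by
    rw [← Fin.map_valEmbedding_Ici, Finset.sum_map]
    rfl
  have h2 : ∀ k, ∑ k ∈ Finset.Ico (i : ℕ) (i + k), (a' k - a' (k + 1)) = a' i - a' (i + k) := by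
    intro k
    induction k with
    | zero => simp
    | succ k ih =>
      rw [← add_assoc, Finset.sum_Ico_succ_top (by omega), ih]
      abel
  have h3 := h2 (n - i)
  rw [show (i : ℕ) + (n - i) = n by omega] at h3
  rw [h1, h3]
  simp [a']

/-- The fermions below the diagonal of a diagram with `m j` columns of height `j + 1`. -/
def columns (m : Fin n → ℕ) : Finset (Fin n × Σ j : Fin n, Fin (m j)) :=
  Finset.univ.filter fun x => x.1 ≤ x.2.1

theorem mem_columns {m : Fin n → ℕ} {i : Fin n} {s : Σ j : Fin n, Fin (m j)} :
    (i, s) ∈ columns m ↔ i ≤ s.1 := by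
  simp [columns]

theorem card_columns (m : Fin n → ℕ) (i : Fin n) :
    (Finset.univ.filter fun s => (i, s) ∈ columns m).card = ∑ j ∈ Finset.Ici i, m j := by
  have : (Finset.univ.filter fun s => (i, s) ∈ columns m) =
      (Finset.Ici i).sigma fun _ => Finset.univ := by
    ext s
    simp [mem_columns]
  rw [this, Finset.card_sigma]
  simp

variable {M : Type*} [AddCommGroup M] [Module F M] {m : Fin n → ℕ}
  {O : Oscillator n (Σ j : Fin n, Fin (m j)) F M} {v : M}

/-- The columns are filled from the top, so raising operators run into filled states; the weight is
given by the row lengths modulo p. -/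
theorem isSingular_of_isOcc (h : O.IsOcc (columns m) v) {a : Fin n → ZMod p}
    (ha : ∀ i, ((∑ j ∈ Finset.Ici i, m j : ℕ) : ZMod p) = a i) :
    IsSingular (O.action p) a v where
  ne_zero := h.ne_zero
  upper A hA := by
    rw [O.action_ι, h.op_aElt]
    · simp [hA]
    · intro i j s hij hs
      rw [mem_columns] at hs ⊢
      by_contra hc
      exact hij (hA _ _ (hs.trans (not_le.1 hc).le))
  degOne B hB := by rw [O.action_ι, h.op_bElt]
  diag d := by
    rw [O.action_ι, h.op_aElt]
    · congr 1
      refine Finset.sum_congr rfl fun i _ => ?_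
      rw [Matrix.diagonal_apply_eq, card_columns, pt, ← ha, map_natCast]
    · intro i j s hij hs
      by_cases hc : j = i
      · rwa [hc]
      · exact absurd (Matrix.diagonal_apply_ne d hc) hij

theorem exists_isSingular (a : Fin n → ZMod p) : ∃ (m : Fin n → ℕ)
    (v : Fock n (Σ j : Fin n, Fin (m j)) F), IsSingular ((fock n _ F).action p) a v := by
  obtain ⟨d, hd⟩ := exists_sum_Ici_eq a
  obtain ⟨v, hv⟩ := (fock n (Σ j : Fin n, Fin ((d j).val)) F).exists_isOcc (columns _)
  exact ⟨_, v, isSingular_of_isOcc hv fun i => by simp [hd]⟩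

/-- Adding p columns of every height leaves the weight unchanged and supplies at least p columns
ending at row i, in which i is filled and j is empty. -/
theorem exists_isSingular_lowering (a : Fin n → ZMod p) {i j : Fin n} (hij : (j : ℕ) = i + 1)
    {k : ℕ} (hk : k < p) : ∃ (m : Fin n → ℕ) (v : Fock n (Σ j : Fin n, Fin (m j)) F),
      IsSingular ((fock n _ F).action p) a v ∧
      (((fock n _ F).action p (ιu n F p (aElt (Matrix.single j i (1 : F))))) ^ k) v ≠ 0 := by
  obtain ⟨d, hd⟩ := exists_sum_Ici_eq a
  obtain ⟨v, hv⟩ := (fock n (Σ j : Fin n, Fin ((d j).val + p)) F).exists_isOcc (columns _)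
  refine ⟨_, v, isSingular_of_isOcc hv fun i => by simp [hd], ?_⟩
  rw [Oscillator.action_ι]
  refine hv.lowering_pow_ne_zero (by rintro rfl; omega) hk
    (({i} : Finset (Fin n)).sigma fun _ => Finset.univ) ?_ ?_
  · intro s hs
    simp only [Finset.mem_sigma, Finset.mem_singleton, Finset.mem_univ, and_true] at hs
    rw [mem_columns, mem_columns, hs]
    refine ⟨le_rfl, ?_⟩
    rw [Fin.le_def]
    omega
  · rw [Finset.card_sigma, Finset.sum_singleton, Finset.card_univ, Fintype.card_fin]
    omega

/-- Since a_i = a_j, no column need end at row i, so e_{ji} kills v by exclusion. The p additional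
full columns do not affect the weight but guarantee a fermion in row j, on which c acts
nontrivially. -/
theorem exists_isSingular_cElt {a : Fin n → ZMod p} {i j : Fin n} (hi : (i : ℕ) + 2 = n)
    (hj : (j : ℕ) + 1 = n) (haij : a i = a j) :
    ∃ (m : Fin n → ℕ) (v : Fock n (Σ j : Fin n, Fin (m j)) F),
      IsSingular ((fock n _ F).action p) a v ∧
      IsSingular ((fock n _ F).action p) (a - Pi.single i 1 - Pi.single j 1)
        ((fock n _ F).action p
          (ιu n F p (cElt (skewSingle i j) (skewSingle_transpose i j))) v) := by
  have hij : i ≠ j := by rintro rfl; omega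
  obtain ⟨d, hd⟩ := exists_sum_Ici_eq a
  have hdi : d i = 0 := by
    have h1 := hd i
    have h2 : Finset.Ici i = insert i (Finset.Ici j) := by
      ext k
      simp only [Finset.mem_Ici, Finset.mem_insert, Fin.le_def, Fin.ext_iff]
      omega
    have h3 : i ∉ Finset.Ici j := by
      rw [Finset.mem_Ici, Fin.le_def]
      omega
    rw [h2, Finset.sum_insert h3, hd, haij] at h1
    simpa using h1
  obtain ⟨v, hv⟩ := (fock n (Σ k : Fin n, Fin ((d k).val + if k = j then p else 0)) F).exists_isOcc
    (columns _)
  have hs : IsSingular ((fock n _ F).action p) a v :=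
    isSingular_of_isOcc hv fun i => by simp [apply_ite, hd]
  refine ⟨_, v, hs, hs.cElt_skewSingle hi hj haij ?_ ?_⟩
  · rw [Oscillator.action_ι, hv.op_aElt]
    · simp [Matrix.single_apply, hij, ite_and]
    · intro r c s hrc hD
      rw [mem_columns] at hD ⊢
      rw [Matrix.single_apply, ne_eq, ite_eq_right_iff, Classical.not_imp] at hrc
      obtain ⟨⟨rfl, rfl⟩, -⟩ := hrc
      have hne : s.1 ≠ i := by
        rintro rfl
        have h3 := s.2.2
        generalize (s.2 : ℕ) = x at h3
        rw [hdi, if_neg hij] at h3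
        simp at h3
      have := Fin.val_ne_of_ne hne
      rw [Fin.le_def] at hD ⊢
      omega
  · rw [Oscillator.action_ι]
    have hp := (Fact.out : p.Prime).pos
    refine hv.op_cElt_ne_zero (i := i) (j := j) (s := ⟨j, ⟨0, by simp [hp]⟩⟩) _
      (mem_columns.2 le_rfl) ?_
    simp [skewSingle, hij, hij.symm]

end Highest

/-! ### Conditions on the Harish-Chandra image of 𝒵. -/

section Centre

variable {n : ℕ} {F : Type*} [Field F] {p : ℕ} [Fact p.Prime] [CharP F p]

theorem Z_commute_odd {z : ubar n F p} (hz : z ∈ Z n F p) {x : pn n F} (hx : x ∈ odd n F) :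
    z * ι n F p x = ι n F p x * z :=
  ((Subalgebra.mem_centralizer_iff F).1 hz.2 _ ⟨x, hx, rfl⟩).symm

/-- e_{ji} is the anticommutator of the odd elements with blocks b = e_{jj} and c = e_{ji} - e_{ij},
and z commutes with both. -/
theorem Z_commute_lowering {z : ubar n F p} (hz : z ∈ Z n F p) {i j : Fin n} (hij : i ≠ j) :
    z * ι n F p (aElt (Matrix.single j i (1 : F))) =
      ι n F p (aElt (Matrix.single j i (1 : F))) * z := by
  have hB : (Matrix.single j j (1 : F)).transpose = Matrix.single j j (1 : F) := by simp
  have h := bracket_bc (mkubar n F p) _ hB (skewSingle j i) (skewSingle_transpose j i)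
  have hBC : Matrix.single j j (1 : F) * skewSingle j i = Matrix.single j i 1 := by
    simp [skewSingle, mul_sub, hij.symm]
  rw [hBC] at h
  have hb := Z_commute_odd hz (bElt_mem _ hB).1
  have hc := Z_commute_odd hz (cElt_mem _ (skewSingle_transpose (F := F) j i)).1
  have h2 : ι n F p (aElt (Matrix.single j i (1 : F))) =
      ι n F p (bElt _ hB) * ι n F p (cElt _ (skewSingle_transpose j i)) +
        ι n F p (cElt _ (skewSingle_transpose j i)) * ι n F p (bElt _ hB) := by
    change ι n F p _ * ι n F p _ = -(ι n F p _ * ι n F p _) + ι n F p _ at h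
    rw [h]
    abel
  have hb' : Commute z _ := hb
  have hc' : Commute z _ := hc
  rw [h2]
  exact (hb'.mul_right hc').add_right (hc'.mul_right hb')

/-- z acts by the scalars f(a) on v and f(b) on w = x^k v; as it commutes with x, the scalars agree.
-/
theorem evalUh_eq_of_action_eq {M : Type*} [AddCommGroup M] [Module F M]
    {Φ : u n F p →ₐ[F] Module.End F M} (hp : p ≠ 2) {a b : Fin n → ZMod p} {v w : M}
    (hv : IsSingular Φ a v) (hw : IsSingular Φ b w) {x : pn n F} {k : ℕ}
    (hx : (Φ (ιu n F p x) ^ k) v = w) {z : ubar n F p} {f : uh n F p}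
    (hz : z - uhToUbar n F p f ∈ lIdeal n F p) (hzx : z * ι n F p x = ι n F p x * z) :
    evalUh F a f = evalUh F b f := by
  have hv' := layer_zero_le_nilPart Φ hp hv.mem_layer
  have hw' := layer_zero_le_nilPart Φ hp hw.mem_layer
  have h1 := nilAction_singular hv hv' hz
  have h2 := nilAction_singular hw hw' hz
  have h3 : ∀ k, (((nilAction Φ (ι n F p x)) ^ k) ⟨v, hv'⟩ : M) = (Φ (ιu n F p x) ^ k) v := by
    intro k
    induction k with
    | zero => rfl
    | succ k ih => rw [pow_succ', pow_succ', Module.End.mul_apply, nilAction_ι, ih]; rfl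
  have h4 : (⟨w, hw'⟩ : nilPart Φ) = ((nilAction Φ (ι n F p x)) ^ k) ⟨v, hv'⟩ :=
    Subtype.ext (by rw [h3, hx])
  have h5 : nilAction Φ z ⟨w, hw'⟩ = evalUh F a f • ⟨w, hw'⟩ := by
    rw [h4, ← map_smul, ← h1, ← map_pow, ← Module.End.mul_apply, ← Module.End.mul_apply,
      ← map_mul, ← map_mul, (show Commute z (ι n F p x) from hzx).pow_right k]
  rw [h2] at h5
  have h6 := congrArg Subtype.val h5
  exact (smul_left_injective F hw.ne_zero h6).symm

/-- ū 𝔫⁺ kills highest weight vectors, and there is one of every weight, so f vanishes everywhere.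
This contains both the injectivity of u(𝔥) → ū and u(𝔥) ∩ 𝔩 = 0. -/
theorem uhToUbar_mem_lIdeal (hp : p ≠ 2) {f : uh n F p} (h : uhToUbar n F p f ∈ lIdeal n F p) :
    f = 0 := by
  refine uh_ext fun a => ?_
  obtain ⟨m, v, hv⟩ := exists_isSingular (F := F) a
  have hv' := layer_zero_le_nilPart _ hp hv.mem_layer
  have h1 := nilAction_singular hv hv' (z := 0) (f := -f) (by simpa using h)
  rw [map_zero, map_neg, LinearMap.zero_apply] at h1
  have h2 : (0 : Fock n (Σ j : Fin n, Fin (m j)) F) = (-(evalUh F a f)) • v :=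
    congrArg Subtype.val h1
  exact neg_eq_zero.1 ((smul_eq_zero.1 h2.symm).resolve_right hv.ne_zero)

theorem dotWeight_mul (w w' : Equiv.Perm (Fin n)) (a : Fin n → ZMod p) :
    dotWeight (w * w') a = dotWeight w (dotWeight w' a) := by
  funext i
  simp [dotWeight]

theorem evalUh_dotWeight_swap (hp : p ≠ 2) {z : ubar n F p} (hz : z ∈ Z n F p) {f : uh n F p}
    (hf : z - uhToUbar n F p f ∈ lIdeal n F p) {i j : Fin n} (hij : (j : ℕ) = i + 1)
    (a : Fin n → ZMod p) : evalUh F (dotWeight (Equiv.swap i j) a) f = evalUh F a f := by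
  obtain ⟨m, v, hv, hne⟩ := exists_isSingular_lowering (F := F) a hij (ZMod.val_lt (a i - a j + 1))
  exact (evalUh_eq_of_action_eq hp hv (hv.lowering_pow hij (by simp) hne) rfl hf
    (Z_commute_lowering hz (by rintro rfl; omega))).symm

theorem evalUh_dotWeight (hp : p ≠ 2) {z : ubar n F p} (hz : z ∈ Z n F p) {f : uh n F p}
    (hf : z - uhToUbar n F p f ∈ lIdeal n F p) (w : Equiv.Perm (Fin n)) (a : Fin n → ZMod p) :
    evalUh F (dotWeight w a) f = evalUh F a f := by
  rcases n with _ | n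
  · rw [Subsingleton.elim (dotWeight w a) a]
  have hw : w ∈ Submonoid.closure
      (Set.range fun i : Fin n => Equiv.swap i.castSucc i.succ) := by
    rw [Equiv.Perm.mclosure_swap_castSucc_succ]
    trivial
  induction hw using Submonoid.closure_induction generalizing a with
  | mem w hw =>
    obtain ⟨i, rfl⟩ := hw
    exact evalUh_dotWeight_swap hp hz hf (by simp) a
  | one => rw [show dotWeight 1 a = a by funext i; simp [dotWeight]]
  | mul w w' _ _ h h' => rw [dotWeight_mul, h, h']

theorem hcZ_subset (hn : 2 ≤ n) (hp : p ≠ 2) {f : uh n F p} (hf : f ∈ hcZ n F p) :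
    ∃ q ∈ uhInv n F p, ∃ c : F, f = theta n F p * q + algebraMap F (uh n F p) c := by
  obtain ⟨z, hz, -, hf⟩ := hf
  have hW := evalUh_dotWeight hp hz hf
  refine exists_eq_theta_mul_add hW fun a b ha hb => ?_
  obtain ⟨i, j, hij, h1⟩ := evalUh_theta_eq_zero ha
  obtain ⟨i', j', hij', h2⟩ := evalUh_theta_eq_zero hb
  let i₀ : Fin n := ⟨n - 2, by omega⟩
  let j₀ : Fin n := ⟨n - 1, by omega⟩
  have hi₀ : (i₀ : ℕ) + 2 = n := by show n - 2 + 2 = n; omega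
  have hj₀ : (j₀ : ℕ) + 1 = n := by show n - 1 + 1 = n; omega
  have h₀ : i₀ ≠ j₀ := by intro h; rw [h] at hi₀; omega
  have hrho : (rho i₀ : ZMod p) = rho j₀ + 1 := by
    have : (j₀ : ℕ) = i₀ + 1 := by omega
    simp [rho, this]
  -- In l = a + ρ the dot action permutes coordinates, and a_{i₀} = a_{j₀} reads l_{i₀} = l_{j₀} + 1
  -- because ρ drops by 1 from i₀ to j₀.
  have key := eq_of_symmetric_of_shift hp (fun l : Fin n → ZMod p => evalUh F (l - rho) f)
    (fun w l => by
      rw [← hW w⁻¹ (l - rho)]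
      congr 2
      funext k
      simp [dotWeight]) h₀
    (fun l hl => by
      have hl' : (l - rho : Fin n → ZMod p) i₀ = (l - rho : Fin n → ZMod p) j₀ := by
        rw [Pi.sub_apply, Pi.sub_apply, hl, hrho]; ring
      obtain ⟨m, v, hv, hw⟩ := exists_isSingular_cElt (F := F) hi₀ hj₀ hl'
      rw [evalUh_eq_of_action_eq hp hv hw (k := 1) (by rw [pow_one]) hf
        (Z_commute_odd hz (cElt_mem _ _).1)]
      congr 2
      funext k
      by_cases hk : k = j₀
      · subst hk; simp [h₀.symm]; ring
      · by_cases hk' : k = i₀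
        · subst hk'; simp [h₀, hl]; ring
        · simp [hk, hk'])
    (l := a + rho) (l' := b + rho) hij h1 hij' h2
  simpa using key

end Centre

/-! ### Weights of root vectors for the torus. -/

section Torus

variable {n : ℕ} {F : Type*} [Field F]

theorem Ad_torus_aElt (s : Fin n → Fˣ) (A : Matrix (Fin n) (Fin n) F) :
    Ad (torus s) (aElt A) = aElt (Matrix.of fun r c => (s r : F) * A r c * (s c : F)⁻¹) := by
  ext1
  refine (conj_fromBlocks (torus s) A 0 0 (-A.transpose)).trans ?_
  simp only [aElt, torus]
  congr 1
  · ext r c; simp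
  · simp
  · simp
  · ext r c; simp; ring

theorem Ad_torus_bElt (s : Fin n → Fˣ) (B : Matrix (Fin n) (Fin n) F) (hB : B.transpose = B) :
    Ad (torus s) (bElt B hB) = bElt (Matrix.of fun r c => (s r : F) * B r c * (s c : F)) (by
      ext r c
      have := congrFun₂ hB r c
      simp only [Matrix.transpose_apply, Matrix.of_apply] at this ⊢
      rw [this]; ring) := by
  ext1
  refine (conj_fromBlocks (torus s) 0 B 0 0).trans ?_
  simp only [bElt, torus]
  congr 1
  · simp
  · ext r c; simp
  · simp
  · simp

theorem Ad_torus_cElt (s : Fin n → Fˣ) (C : Matrix (Fin n) (Fin n) F) (hC : C.transpose = -C) :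
    Ad (torus s) (cElt C hC) =
      cElt (Matrix.of fun r c => (s r : F)⁻¹ * C r c * (s c : F)⁻¹) (by
        ext r c
        have := congrFun₂ hC r c
        simp only [Matrix.transpose_apply, Matrix.of_apply, Matrix.neg_apply] at this ⊢
        rw [this]; ring) := by
  ext1
  refine (conj_fromBlocks (torus s) 0 0 C 0).trans ?_
  simp only [cElt, torus]
  congr 1
  · simp
  · simp
  · ext r c; simp
  · simp

theorem Ad_torus_hElt (s : Fin n → Fˣ) (i : Fin n) : Ad (torus s) (hElt F i) = hElt F i := by
  rw [hElt_eq_aElt, Ad_torus_aElt]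
  congr 1
  ext r c
  rw [Matrix.of_apply, Matrix.diagonal_apply]
  split_ifs with h
  · subst h
    field_simp
  · simp

theorem aElt_mem_nPlus {A : Matrix (Fin n) (Fin n) F} (hA : ∀ i j, j ≤ i → A i j = 0) :
    aElt A ∈ nPlus n F := ⟨rfl, hA⟩

theorem bElt_mem_nPlus (B : Matrix (Fin n) (Fin n) F) (hB : B.transpose = B) :
    bElt B hB ∈ nPlus n F := ⟨rfl, fun _ _ _ => rfl⟩

theorem Ad_torus_nPlus (s : Fin n → Fˣ) {x : pn n F} (hx : x ∈ nPlus n F) :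
    Ad (torus s) x ∈ nPlus n F := by
  obtain ⟨A, B, hB, hA, rfl⟩ := exists_eq_of_mem_nPlus hx
  rw [map_add, Ad_torus_aElt, Ad_torus_bElt]
  refine add_mem (aElt_mem_nPlus fun i j hij => ?_) (bElt_mem_nPlus _ _)
  rw [Matrix.of_apply, hA i j hij]
  simp

/-- A one-parameter subgroup of the torus that is positive on the positive roots. -/
def torusOne (t : Fˣ) : GL (Fin n) F := torus fun i => t ^ (n - (i : ℕ))

/-- `y` is a homogeneous element of weight `-w`, `w > 0`, for the one-parameter subgroup
`torusOne`. -/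
def IsNeg (w : ℕ) (y : pn n F) : Prop :=
  0 < w ∧ (y ∈ even n F ∨ y ∈ odd n F) ∧ ∀ t : Fˣ, Ad (torusOne t) y = ((t : F) ^ w)⁻¹ • y

/-- The exponents n - i of `torusOne` are positive and strictly decreasing, so both ε_i - ε_j for i
< j and all ε_i + ε_j have positive weight. -/
theorem isNeg_aElt {i j : Fin n} (hij : i < j) :
    IsNeg ((j : ℕ) - i) (aElt (Matrix.single j i (1 : F))) := by
  refine ⟨Nat.sub_pos_of_lt hij, Or.inl (aElt_even _), fun t => ?_⟩
  rw [torusOne, Ad_torus_aElt, ← aElt_smul]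
  congr 1
  ext r c
  rw [Matrix.of_apply, Matrix.smul_apply, Matrix.single_apply]
  split_ifs with h
  · obtain ⟨rfl, rfl⟩ := h
    have h1 : n - (i : ℕ) = (n - (j : ℕ)) + ((j : ℕ) - i) := by
      have := Fin.lt_def.1 hij
      have := j.2
      omega
    rw [h1, Units.val_pow_eq_pow_val, Units.val_pow_eq_pow_val, pow_add]
    rw [smul_eq_mul, mul_one, mul_one, mul_inv, ← mul_assoc,
      mul_inv_cancel₀ (pow_ne_zero _ t.ne_zero), one_mul]
  · simp

theorem isNeg_cElt (i j : Fin n) :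
    IsNeg ((n - (i : ℕ)) + (n - (j : ℕ)))
      (cElt (skewSingle i j : Matrix (Fin n) (Fin n) F) (skewSingle_transpose i j)) := by
  refine ⟨by have := i.2; omega, Or.inr (cElt_mem _ _).1, fun t => ?_⟩
  have h0 : (Matrix.of fun r c : Fin n => ((t ^ (n - (r : ℕ)) : Fˣ) : F)⁻¹ *
      (skewSingle i j : Matrix (Fin n) (Fin n) F) r c * ((t ^ (n - (c : ℕ)) : Fˣ) : F)⁻¹) =
      ((t : F) ^ ((n - (i : ℕ)) + (n - (j : ℕ))))⁻¹ • skewSingle i j := by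
    ext r c
    rw [Matrix.of_apply, Matrix.smul_apply, smul_eq_mul, Units.val_pow_eq_pow_val,
      Units.val_pow_eq_pow_val, pow_add, mul_inv]
    by_cases h1 : i = r ∧ j = c
    · rw [h1.1, h1.2]; ring
    by_cases h2 : j = r ∧ i = c
    · rw [h2.1, h2.2]; ring
    rw [skewSingle, Matrix.sub_apply, Matrix.single_apply, Matrix.single_apply, if_neg h1,
      if_neg h2]
    ring
  rw [torusOne, Ad_torus_cElt, cElt_congr h0, cElt_smul _ _ (skewSingle_transpose i j)]

theorem mem_of_forall_isNeg (h2 : (2 : F) ≠ 0) (K : Submodule F (pn n F))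
    (hneg : ∀ w y, IsNeg w y → y ∈ K) (hh : ∀ i, hElt F i ∈ K) (hp : nPlus n F ≤ K) (x : pn n F) :
    x ∈ K := by
  obtain ⟨A, B, hB, C, hC, rfl⟩ := exists_decomp x
  refine add_mem (add_mem ?_ (hp (bElt_mem_nPlus B hB))) ?_
  · let f : Matrix (Fin n) (Fin n) F →ₗ[F] pn n F :=
      { toFun := aElt, map_add' := aElt_add, map_smul' := aElt_smul }
    show f A ∈ K
    rw [Matrix.matrix_eq_sum_single A, map_sum]
    refine K.sum_mem fun i _ => ?_
    rw [map_sum]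
    refine K.sum_mem fun j _ => ?_
    rw [show Matrix.single i j (A i j) = A i j • Matrix.single i j (1 : F) by simp, map_smul]
    refine K.smul_mem _ ?_
    rcases lt_trichotomy i j with h | rfl | h
    · refine hp (aElt_mem_nPlus fun r c hrc => ?_)
      rw [Matrix.single_apply, if_neg]
      rintro ⟨rfl, rfl⟩
      exact absurd h (not_lt.2 hrc)
    · have := hh i
      rw [hElt_eq_aElt] at this
      rwa [← Matrix.diagonal_single]
    · exact hneg _ _ (isNeg_aElt h)
  · have h : cElt C hC =
        ∑ i, ∑ j, (C i j / 2) • cElt (skewSingle i j) (skewSingle_transpose i j) := by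
      ext1
      have hs : ∀ i j, C j i = -C i j := congrFun₂ hC
      have h0 : C = ∑ i, ∑ j, (C i j / 2) • skewSingle i j := by
        ext r c
        simp only [Matrix.sum_apply, Matrix.smul_apply, skewSingle, Matrix.sub_apply,
          Matrix.single_apply, smul_eq_mul, mul_sub, Finset.sum_sub_distrib, ite_and, mul_ite,
          mul_one, mul_zero, Finset.sum_ite_eq', Finset.mem_univ, if_true, Finset.sum_ite_irrel]
        simp
        rw [hs r c]
        field_simp
        ring
      rw [AddSubmonoidClass.coe_finsetSum]
      simp only [AddSubmonoidClass.coe_finsetSum]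
      ext (r | r) (c | c)
      · simp [cElt, Matrix.sum_apply]
      · simp [cElt, Matrix.sum_apply]
      · have := congrFun₂ h0 r c
        simpa [cElt, Matrix.sum_apply] using this
      · simp [cElt, Matrix.sum_apply]
    rw [h]
    exact K.sum_mem fun i _ => K.sum_mem fun j _ => K.smul_mem _ (hneg _ _ (isNeg_cElt i j))

end Torus

/-! ### Triangular decomposition of ū and existence of the projection. -/

section Triangular

variable {n : ℕ} {F : Type*} [Field F] {p : ℕ} [Fact p.Prime] [CharP F p]

variable (n F p) in
/-- The left ideal `ū 𝔫⁺`. -/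
noncomputable abbrev leftIdeal : Ideal (ubar n F p) :=
  Ideal.span (ι n F p '' (nPlus n F : Set (pn n F)))

theorem ι_mem_leftIdeal {x : pn n F} (hx : x ∈ nPlus n F) : ι n F p x ∈ leftIdeal n F p :=
  Ideal.subset_span ⟨x, hx, rfl⟩

/-- 𝔥 normalises 𝔫⁺, so elements of 𝔫⁺ can be moved to the right of the h_i. -/
theorem nPlus_mul_poly (q : MvPolynomial (Fin n) F) {x : pn n F} (hx : x ∈ nPlus n F) :
    ι n F p x * polyToUbar n F p q ∈ leftIdeal n F p := by
  induction q using MvPolynomial.induction_on generalizing x with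
  | C c =>
    rw [show (MvPolynomial.C c : MvPolynomial (Fin n) F) = algebraMap F _ c from rfl,
      AlgHom.commutes, ← Algebra.commutes]
    exact Ideal.mul_mem_left _ _ (ι_mem_leftIdeal hx)
  | add f g hf hg => rw [map_add, mul_add]; exact add_mem (hf hx) (hg hx)
  | mul_X f i hf =>
    obtain ⟨x', hx', h⟩ : ∃ x' ∈ nPlus n F, ι n F p x * ι n F p (hElt F i) =
        ι n F p (hElt F i) * ι n F p x + ι n F p x' := by
      obtain ⟨A, B, hB, hA, rfl⟩ := exists_eq_of_mem_nPlus hx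
      have h1 := bracket_aa (mkubar n F p) A (Matrix.diagonal (Pi.single i 1))
      have h2 := bracket_ab (mkubar n F p) (Matrix.diagonal (Pi.single i 1)) B hB
      refine ⟨_, sub_mem (aElt_mem_nPlus (A := A * Matrix.diagonal (Pi.single i 1) -
        Matrix.diagonal (Pi.single i 1) * A) ?_) (bElt_mem_nPlus _ (bracket_ab_symm
          (Matrix.diagonal (Pi.single i 1)) hB)), ?_⟩
      · intro r c hrc
        simp [Matrix.mul_diagonal, Matrix.diagonal_mul, hA r c hrc]
      · rw [hElt_eq_aElt, map_add, map_sub, add_mul, mul_add]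
        change ι n F p _ * ι n F p _ = ι n F p _ * ι n F p _ + ι n F p _ at h1
        change ι n F p _ * ι n F p _ = ι n F p _ * ι n F p _ + ι n F p _ at h2
        rw [h1, h2]
        abel
    rw [mul_comm, map_mul, polyToUbar_X, ← mul_assoc, h, add_mul, mul_assoc]
    exact add_mem (Ideal.mul_mem_left _ _ (hf hx)) (hf hx')

theorem ι_mul_ι_homogeneous {x y : pn n F} (hx : x ∈ even n F ∨ x ∈ odd n F)
    (hy : y ∈ even n F ∨ y ∈ odd n F) : ∃ (ε : F) (z : pn n F),
      ι n F p x * ι n F p y = ε • (ι n F p y * ι n F p x) + ι n F p z := by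
  rcases hx with hx | hx
  · exact ⟨1, _, by rw [one_smul]; exact ι_comm p x y hx hy⟩
  rcases hy with hy | hy
  · have h := ι_comm p y x hy (Or.inr hx)
    exact ⟨1, -_, by rw [one_smul, map_neg, h]; abel⟩
  · exact ⟨-1, _, by rw [neg_one_smul]; exact ι_anticomm p x y hx hy⟩

variable (n F p) in
/-- The sum of `ū 𝔫⁺` and the span of the products of negative root vectors and elements of
`u(𝔥)`. -/
noncomputable def triangular : Submodule F (ubar n F p) :=
  Submodule.span F {a | ∃ (l : List (pn n F)) (q : MvPolynomial (Fin n) F),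
    (∀ y ∈ l, ∃ w, IsNeg w y) ∧ (l.map (ι n F p)).prod * polyToUbar n F p q = a} ⊔
  (leftIdeal n F p).restrictScalars F

theorem prod_mem_triangular {l : List (pn n F)} (hl : ∀ y ∈ l, ∃ w, IsNeg w y)
    (q : MvPolynomial (Fin n) F) :
    (l.map (ι n F p)).prod * polyToUbar n F p q ∈ triangular n F p :=
  Submodule.mem_sup_left (Submodule.subset_span ⟨l, q, hl, rfl⟩)

theorem triangular_induction {C : ubar n F p → Prop} (add : ∀ a b, C a → C b → C (a + b))
    (smul : ∀ (c : F) a, C a → C (c • a))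
    (prod : ∀ (l : List (pn n F)) q, (∀ y ∈ l, ∃ w, IsNeg w y) →
      C ((l.map (ι n F p)).prod * polyToUbar n F p q))
    (left : ∀ a ∈ leftIdeal n F p, C a) {a : ubar n F p} (ha : a ∈ triangular n F p) : C a := by
  obtain ⟨b, hb, c, hc, rfl⟩ := Submodule.mem_sup.1 ha
  refine add _ _ ?_ (left c hc)
  refine Submodule.span_induction (p := fun b _ => C b) ?_ (left 0 (zero_mem _))
    (fun x y _ _ hx hy => add _ _ hx hy) (fun c x _ hx => smul c x hx) hb
  rintro _ ⟨l, q, hl, rfl⟩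
  exact prod l q hl

theorem neg_mul_mem_triangular {w : ℕ} {y : pn n F} (hy : IsNeg w y) {a : ubar n F p}
    (ha : a ∈ triangular n F p) : ι n F p y * a ∈ triangular n F p := by
  refine triangular_induction (C := fun a => ι n F p y * a ∈ triangular n F p) ?_ ?_ ?_ ?_ ha
  · intro a b ha hb
    rw [mul_add]; exact add_mem ha hb
  · intro c a ha
    rw [mul_smul_comm]; exact Submodule.smul_mem _ _ ha
  · intro l q hl
    have := prod_mem_triangular (p := p) (l := y :: l)
      (List.forall_mem_cons.2 ⟨⟨w, hy⟩, hl⟩) q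
    rwa [List.map_cons, List.prod_cons, mul_assoc] at this
  · intro a ha
    exact Submodule.mem_sup_right (Ideal.mul_mem_left _ _ ha)

/-- Straightening by induction on the length of the word: moving x past its first letter leaves x,
or a bracket, in front of a shorter word. Only a spanning set is needed, so the negative letters are
not ordered. -/
theorem ι_mul_mem_triangular (hp : p ≠ 2) (x : pn n F) {a : ubar n F p}
    (ha : a ∈ triangular n F p) : ι n F p x * a ∈ triangular n F p := by
  refine triangular_induction (C := fun a => ι n F p x * a ∈ triangular n F p) ?_ ?_ ?_ ?_ ha
  · intro a b ha hb
    rw [mul_add]; exact add_mem ha hb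
  · intro c a ha
    rw [mul_smul_comm]; exact Submodule.smul_mem _ _ ha
  · intro l q hl
    clear ha
    induction l generalizing x with
    | nil =>
      rw [List.map_nil, List.prod_nil, one_mul]
      refine mem_of_forall_isNeg (two_ne_zero_of_char hp)
        ((triangular n F p).comap (LinearMap.mulRight F (polyToUbar n F p q) ∘ₗ ι n F p))
        ?_ ?_ ?_ x
      · intro w y hy
        have := prod_mem_triangular (p := p) (l := [y]) (by simpa using ⟨w, hy⟩) q
        simpa using this
      · intro i
        have := prod_mem_triangular (p := p) (l := []) (by simp) (MvPolynomial.X i * q)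
        rw [map_mul, polyToUbar_X] at this
        simpa using this
      · intro e he
        exact Submodule.mem_sup_right (nPlus_mul_poly q he)
    | cons y l ih =>
      obtain ⟨⟨w, hy⟩, hl'⟩ := List.forall_mem_cons.1 hl
      have key : ∀ x : pn n F, x ∈ even n F ∨ x ∈ odd n F →
          ι n F p x * (((y :: l).map (ι n F p)).prod * polyToUbar n F p q) ∈
            triangular n F p := by
        intro x hx
        obtain ⟨ε, z, h⟩ := ι_mul_ι_homogeneous (p := p) hx hy.2.1
        rw [List.map_cons, List.prod_cons, mul_assoc, ← mul_assoc, h, add_mul, smul_mul_assoc,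
          mul_assoc]
        exact add_mem (Submodule.smul_mem _ _ (neg_mul_mem_triangular hy (ih x hl')))
          (ih z hl')
      obtain ⟨A, B, hB, C, hC, rfl⟩ := exists_decomp x
      rw [map_add, map_add, add_mul, add_mul]
      exact add_mem (add_mem (key _ (Or.inl (aElt_even A))) (key _ (Or.inr (bElt_mem B hB).1)))
        (key _ (Or.inr (cElt_mem C hC).1))
  · intro a ha
    exact Submodule.mem_sup_right (Ideal.mul_mem_left _ _ ha)

theorem triangular_eq_top (hp : p ≠ 2) (a : ubar n F p) : a ∈ triangular n F p := by
  have key : ∀ b ∈ triangular n F p, a * b ∈ triangular n F p := by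
    induction a using ubar_induction with
    | algebraMap r =>
      intro b hb
      rw [← Algebra.smul_def]
      exact Submodule.smul_mem _ _ hb
    | ι x => exact fun b hb => ι_mul_mem_triangular hp x hb
    | mul a b ha hb =>
      intro c hc
      rw [mul_assoc]
      exact ha _ (hb _ hc)
    | add a b ha hb =>
      intro c hc
      rw [add_mul]
      exact add_mem (ha _ hc) (hb _ hc)
  have h1 := key 1 (by
    have := prod_mem_triangular (n := n) (F := F) (p := p) (l := []) (by simp) 1
    simpa using this)
  rwa [mul_one] at h1

theorem act_torus_poly (s : Fin n → Fˣ) (q : MvPolynomial (Fin n) F) :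
    act p (torus s) (polyToUbar n F p q) = polyToUbar n F p q := by
  have : (act p (torus s)).comp (polyToUbar n F p) = polyToUbar n F p := by
    refine MvPolynomial.algHom_ext fun i => ?_
    rw [AlgHom.comp_apply, polyToUbar_X, act_ι, Ad_torus_hElt]
  exact DFunLike.congr_fun this q

theorem poly_mem_ubarT (q : MvPolynomial (Fin n) F) : polyToUbar n F p q ∈ ubarT n F p := by
  rw [ubarT, Algebra.mem_iInf]
  intro s
  exact act_torus_poly s q

theorem act_torus_leftIdeal (s : Fin n → Fˣ) {a : ubar n F p} (ha : a ∈ leftIdeal n F p) :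
    act p (torus s) a ∈ leftIdeal n F p := by
  refine Submodule.span_induction (p := fun a _ => act p (torus s) a ∈ leftIdeal n F p) ?_
    (by simp) (fun x y _ _ hx hy => by rw [map_add]; exact add_mem hx hy)
    (fun r x _ hx => by rw [smul_eq_mul, map_mul]; exact Ideal.mul_mem_left _ _ hx) ha
  rintro _ ⟨x, hx, rfl⟩
  rw [act_ι]
  exact ι_mem_leftIdeal (Ad_torus_nPlus s hx)

theorem act_torusOne_prod {l : List (pn n F)} (hl : ∀ y ∈ l, ∃ w, IsNeg w y) (hne : l ≠ []) :
    ∃ w, 0 < w ∧ ∀ t : Fˣ, act p (torusOne t) (l.map (ι n F p)).prod =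
      ((t : F) ^ w)⁻¹ • (l.map (ι n F p)).prod := by
  induction l with
  | nil => exact absurd rfl hne
  | cons y l ih =>
    obtain ⟨⟨w, hy⟩, hl'⟩ := List.forall_mem_cons.1 hl
    by_cases h : l = []
    · subst h
      refine ⟨w, hy.1, fun t => ?_⟩
      simp [act_ι, hy.2.2 t]
    · obtain ⟨w', -, hw'⟩ := ih hl' h
      refine ⟨w + w', by have := hy.1; omega, fun t => ?_⟩
      rw [List.map_cons, List.prod_cons, map_mul, act_ι, hy.2.2 t, hw', map_smul,
        smul_mul_smul_comm, pow_add, mul_inv]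

/-- The product of the operators `torusOne t - t ^ (-m)`, `1 ≤ m ≤ k`. -/
noncomputable def weightFilter (t : Fˣ) : ℕ → Module.End F (ubar n F p)
  | 0 => 1
  | k + 1 => ((act p (torusOne t)).toLinearMap - ((t : F) ^ (k + 1))⁻¹ • 1) * weightFilter t k

theorem weightFilter_leftIdeal (t : Fˣ) (k : ℕ) {a : ubar n F p} (ha : a ∈ leftIdeal n F p) :
    weightFilter t k a ∈ leftIdeal n F p := by
  induction k with
  | zero => exact ha
  | succ k ih =>
    refine sub_mem (act_torus_leftIdeal _ ih) ?_
    exact ((leftIdeal n F p).restrictScalars F).smul_mem _ ih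

theorem weightFilter_eigen (t : Fˣ) (k : ℕ) {a : ubar n F p} {c : F}
    (ha : act p (torusOne t) a = c • a) :
    weightFilter t k a = (∏ m ∈ Finset.range k, (c - ((t : F) ^ (m + 1))⁻¹)) • a := by
  induction k with
  | zero => simp [weightFilter]
  | succ k ih =>
    rw [weightFilter, Module.End.mul_apply, ih, map_smul, Finset.prod_range_succ, mul_smul]
    congr 1
    simp [ha, sub_smul]

/-- A nonempty negative word has eigenvalue t^(-w) with w > 0 and is killed by the filter once k ≥
w, while ū 𝔫⁺ is stable under it. The bound k₀ does not depend on t, so t may be chosen afterwards.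
-/
theorem exists_weightFilter_mem (hp : p ≠ 2) (a : ubar n F p) :
    ∃ (q : MvPolynomial (Fin n) F) (k₀ : ℕ),
    ∀ k, k₀ ≤ k → ∀ t : Fˣ, weightFilter t k (a - polyToUbar n F p q) ∈ leftIdeal n F p := by
  refine triangular_induction (C := fun a => ∃ (q : MvPolynomial (Fin n) F) (k₀ : ℕ),
    ∀ k, k₀ ≤ k → ∀ t : Fˣ, weightFilter t k (a - polyToUbar n F p q) ∈ leftIdeal n F p)
    ?_ ?_ ?_ ?_ (triangular_eq_top hp a)
  · rintro a b ⟨q, k, h⟩ ⟨q', k', h'⟩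
    refine ⟨q + q', max k k', fun j hj t => ?_⟩
    rw [map_add, add_sub_add_comm, map_add]
    exact add_mem (h j (le_of_max_le_left hj) t) (h' j (le_of_max_le_right hj) t)
  · rintro c a ⟨q, k, h⟩
    refine ⟨c • q, k, fun j hj t => ?_⟩
    rw [map_smul, ← smul_sub, map_smul]
    exact ((leftIdeal n F p).restrictScalars F).smul_mem _ (h j hj t)
  · intro l q hl
    by_cases hne : l = []
    · subst hne
      refine ⟨q, 0, fun j _ t => ?_⟩
      simp
    · obtain ⟨w, hw, h⟩ := act_torusOne_prod (p := p) hl hne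
      refine ⟨0, w, fun j hj t => ?_⟩
      rw [map_zero, sub_zero, weightFilter_eigen (c := ((t : F) ^ w)⁻¹),
        Finset.prod_eq_zero (i := w - 1) (by rw [Finset.mem_range]; omega), zero_smul]
      · exact zero_mem _
      · rw [Nat.sub_add_cancel hw, sub_self]
      · rw [map_mul, h, torusOne, act_torus_poly, smul_mul_assoc]
  · intro a ha
    refine ⟨0, 0, fun j _ t => ?_⟩
    rw [map_zero, sub_zero]
    exact weightFilter_leftIdeal t j ha

/-- The nonzero polynomial X ∏ (X^(m+1) - 1) does not vanish identically on an infinite field. -/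
theorem exists_unit_pow_ne_one [Infinite F] (k : ℕ) :
    ∃ t : Fˣ, ∀ m ∈ Finset.range k, (t : F) ^ (m + 1) ≠ 1 := by
  by_contra! h
  have h0 : (Polynomial.X * ∏ m ∈ Finset.range k, (Polynomial.X ^ (m + 1) - 1) :
      Polynomial F) = 0 := by
    refine Polynomial.funext fun x => ?_
    by_cases hx : x = 0
    · simp [hx]
    · obtain ⟨m, hm, h1⟩ := h (Units.mk0 x hx)
      rw [Polynomial.eval_mul, Polynomial.eval_prod, Finset.prod_eq_zero hm (by
        simpa [sub_eq_zero] using h1)]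
      simp
  rw [mul_eq_zero, Finset.prod_eq_zero_iff] at h0
  rcases h0 with h0 | ⟨m, -, h0⟩
  · exact Polynomial.X_ne_zero h0
  · exact Polynomial.X_pow_sub_C_ne_zero (R := F) (Nat.succ_pos m) 1 (by simpa using h0)

/-- v - q is fixed by the torus, so the filter multiplies it by ∏ (1 - t^(-m)). For suitable t this
scalar is invertible, and v - q itself lies in ū 𝔫⁺. -/
theorem exists_isHCImage [Infinite F] (hp : p ≠ 2) {v : ubar n F p} (hv : v ∈ ubarT n F p) :
    ∃ f : uh n F p, IsHCImage p v f := by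
  obtain ⟨q, k, h⟩ := exists_weightFilter_mem hp v
  refine ⟨Ideal.Quotient.mk _ q, hv, ?_⟩
  obtain ⟨t, ht⟩ := exists_unit_pow_ne_one (F := F) k
  have hq : v - polyToUbar n F p q ∈ ubarT n F p := sub_mem hv (poly_mem_ubarT q)
  refine ⟨?_, hq⟩
  change v - polyToUbar n F p q ∈ leftIdeal n F p
  have hfix : act p (torusOne t) (v - polyToUbar n F p q) = (1 : F) • (v - polyToUbar n F p q) := by
    rw [one_smul]
    rw [ubarT, Algebra.mem_iInf] at hq
    exact hq _
  have h1 := h k le_rfl t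
  rw [weightFilter_eigen t k hfix] at h1
  have hc : ∏ m ∈ Finset.range k, (1 - ((t : F) ^ (m + 1))⁻¹) ≠ 0 := by
    refine Finset.prod_ne_zero_iff.2 fun m hm h0 => ht m hm ?_
    rw [sub_eq_zero, eq_comm, inv_eq_one] at h0
    exact h0
  have h2 := ((leftIdeal n F p).restrictScalars F).smul_mem
    (∏ m ∈ Finset.range k, (1 - ((t : F) ^ (m + 1))⁻¹))⁻¹ h1
  rwa [smul_smul, inv_mul_cancel₀ hc, one_smul] at h2

end Triangular

end Periplectic

theorem theorem3p14 (n : ℕ) (hn : 2 ≤ n) (F : Type*) [Field F] [IsAlgClosed F]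
    (p : ℕ) [Fact p.Prime] [CharP F p] (hp3 : 3 < p) (hp : n * (n - 1) < p) :
    (∀ v ∈ Periplectic.ubarT n F p, ∃! f : Periplectic.uh n F p, Periplectic.IsHCImage p v f) ∧
    Periplectic.hcZ n F p ⊆
      {f | ∃ q ∈ Periplectic.uhInv n F p, ∃ c : F,
        f = Periplectic.theta n F p * q + algebraMap F (Periplectic.uh n F p) c} := by
  have hp2 : p ≠ 2 := by omega
  have : Infinite F := IsAlgClosed.instInfinite
  refine ⟨fun v hv => ?_, fun f hf => Periplectic.hcZ_subset hn hp2 hf⟩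
  obtain ⟨f, hf⟩ := Periplectic.exists_isHCImage hp2 hv
  refine ⟨f, hf, fun g hg => ?_⟩
  rw [← sub_eq_zero]
  refine Periplectic.uhToUbar_mem_lIdeal hp2 ?_
  have := sub_mem hf.2 hg.2
  rwa [sub_sub_sub_cancel_left, ← map_sub] at this
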